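/- Let $K$ be a finite abstract simplicial complex of dimension $d$ and let $\Bbbk$ be a field. A function $f\in\mathbb{R}^K$ on the simplices of $K$ is a filter function if $f(\sigma)\le f(\sigma')$ whenever $\sigma\subseteq\sigma'$; then $\mathrm{Dgm}_p(f)$ denotes the barcode of the persistence module $t\mapsto H_p(\{\sigma\in K : f(\sigma)\le t\};\Bbbk)$, that is, the multiset of points $(\inf J,\sup J)$ over the intervals $J$ of a decomposition into interval modules, together with $\Delta^\infty$ (every point of the diagonal of $\mathbb{R}^2$ with countably infinite multiplicity). Let $Bar$ be the set of multisets $D\cup\Delta^\infty$ with $D$ a finite multiset in $\mathbb{R}\times(\mathbb{R}\cup\{+\infty\})$, and put $\mathrm{Dgm}(f)=(\mathrm{Dgm}_p(f))_{p=0}^d\in Bar^{d+1}$. For $m,n\in\mathbb{N}$ let $Q_{m,n}:\mathbb{R}^{2m}\times\mathbb{R}^n\to Bar$ be the map $$Q_{m,n}(b_1,d_1,\dots,b_m,d_m,v_1,\dots,v_n)=\{(b_i,d_i)\}_{i=1}^m\cup\{(v_j,+\infty)\}_{j=1}^n\cup\Delta^\infty .$$ Two functions $f,g\in\mathbb{R}^K$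 are ordering equivalent if they induce the same pre-order on $K$, i.e. $f(\sigma)\le f(\tau)\Leftrightarrow g(\sigma)\le g(\tau)$ for all $\sigma,\tau\in K$; let $\Omega(\mathbb{R}^K)$ be the set of equivalence classes. Then there are integers $m_p,n_p\ge 0$ ($0\le p\le d$) with $\sum_{p=0}^d(2m_p+n_p)=\#K$ and a map $\mathrm{Perm}:\mathbb{R}^K\to\prod_{p=0}^d\mathbb{R}^{2m_p}\times\mathbb{R}^{n_p}\cong\mathbb{R}^{\#K}$, depending only on $K$ and $\Bbbk$, such that: (1) the restriction of $\mathrm{Perm}$ to each class $S\in\Omega(\mathbb{R}^K)$ is a permutation matrix; (2) for every filter function $f$ the barcodes $\mathrm{Dgm}_p(f)$ exist, and $Q(\mathrm{Perm}(f))=\mathrm{Dgm}(f)$, where $Q=\prod_{p=0}^d Q_{m_p,n_p}$; (3) for every smooth finite-dimensional manifold $\mathcal{M}$ without boundary and every map $F:\mathcal{M}\to\mathbb{R}^K$ whose values are filter functions, the map $\tilde B=\mathrm{Perm}\circ F$ is a global lift of $B=\mathrm{Dgm}\circ F:\mathcal{M}\to Bar^{d+1}$, i.e. $Q\circ\tilde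 B=B$ on $\mathcal{M}$; (4) in the situation of (3), let moreover $r\in\mathbb{N}\cup\{\infty\}$ and let $\mathcal{S}$ be a Whitney stratification of $\mathcal{M}$ such that (i) for each $S\in\Omega(\mathbb{R}^K)$ the preimage $F^{-1}(S)$ is a union of strata, (ii) the restriction of $F$ to each stratum is $C^r$, and (iii) for every $x\in\mathcal{M}$ and every stratum $\mathcal{M}'$ whose closure contains $x$ (an incident stratum), there is an open neighbourhood $U$ of $x$ such that $F|_{\mathcal{M}'\cap U}$ extends to a $C^r$ map $U\to\mathbb{R}^K$. Then for each stratum $\mathcal{M}'$ there is a permutation matrix $\mathrm{Perm}_{\mathcal{M}'}$ with $\tilde B=\mathrm{Perm}_{\mathcal{M}'}\circ F$ on $\mathcal{M}'$. Consequently, at every $x\in\mathcal{M}$ and along every incident stratum $\mathcal{M}'$, each component $B_p$ of $B$ is $r$-differentiable: there are an open neighbourhood $U$ of $x$, integers $m,n$ and a $C^r$ map $U\to\mathbb{R}^{2m}\times\mathbb{R}^n$ (a local lift) whose composition with $Q_{m,n}$ equals $B_p$ on $U\cap\mathcal{M}'$. If $r\ge1$, its directional derivatives are given by those of $\tilde B$: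 call directional derivative of a vector valued map $G$ at $x$ along $\mathcal{M}'$ the differential at $x$ of a $C^r$ extension of $G|_{\mathcal{M}'\cap U}$ to an open neighbourhood $U$ of $x$, and directional derivative of $B_p$ the differential at $x$ of a $C^r$ local lift of $B_p$ along $\mathcal{M}'$; then $\tilde B$ has directional derivatives at $x$ along $\mathcal{M}'$, they are exactly the maps $\mathrm{Perm}_{\mathcal{M}'}\circ D$ with $D$ a directional derivative of $F$ at $x$ along $\mathcal{M}'$, and the component in degree $p$ of each of them is a directional derivative of $B_p$ at $x$ along $\mathcal{M}'$. -/

import Mathlib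

set_option maxSynthPendingDepth 3

open Set Filter Topology
open scoped Manifold ContDiff

universe u v w w'

noncomputable section

/-! ## Persistence modules and their interval decompositions -/

/-- A persistence module over the field `k`: a functor from the poset `(ℝ, ≤)` to vector spaces. -/
structure PersistenceModule (k : Type u) [Field k] where
  obj : ℝ → Type w
  [addCommGroup : ∀ t, AddCommGroup (obj t)]
  [module : ∀ t, Module k (obj t)]
  map : ∀ {s t : ℝ}, s ≤ t → obj s →ₗ[k] obj t
  map_refl : ∀ (t : ℝ) (x : obj t), map (le_refl t) x = x
  map_trans : ∀ {r s t : ℝ} (hrs : r ≤ s) (hst : s ≤ t) (x : obj r),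
    map hst (map hrs x) = map (hrs.trans hst) x

attribute [instance] PersistenceModule.addCommGroup PersistenceModule.module

namespace PersistenceModule

variable {k : Type u} [Field k]

/-- Isomorphism of persistence modules: a natural family of linear isomorphisms. -/
def IsIsomorphic (A : PersistenceModule.{u, w} k) (B : PersistenceModule.{u, w'} k) : Prop :=
  ∃ e : ∀ t, A.obj t ≃ₗ[k] B.obj t,
    ∀ (s t : ℝ) (h : s ≤ t) (x : A.obj s), e t (A.map h x) = B.map h (e s x)

/-- The pointwise direct sum of a finite family of persistence modules. -/
def finiteDirectSum {N : ℕ} (A : Fin N → PersistenceModule.{u, w} k) :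
    PersistenceModule.{u, w} k where
  obj t := ∀ i, (A i).obj t
  map h := LinearMap.pi fun i => (A i).map h ∘ₗ LinearMap.proj i
  map_refl t x := by
    funext i
    simp [(A i).map_refl]
  map_trans hrs hst x := by
    funext i
    simp [(A i).map_trans]

/-- The space at `t` of the interval module of `J`: the field `k` if `t ∈ J`, and zero otherwise. -/
def intervalFibre (k : Type u) [Field k] (J : Set ℝ) (t : ℝ) : Submodule k k where
  carrier := {x | t ∉ J → x = 0}
  add_mem' := by
    intro a b ha hb ht
    rw [ha ht, hb ht, add_zero]
  zero_mem' := fun _ => rfl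
  smul_mem' := by
    intro c a ha ht
    rw [ha ht, smul_zero]

open Classical in
/-- The interval module of an interval `J`: copies of `k` over `J`, zero elsewhere, connected by
identity maps inside `J`. -/
def intervalModule (k : Type u) [Field k] (J : Set ℝ) (hJ : J.OrdConnected) :
    PersistenceModule.{u, u} k where
  obj t := intervalFibre k J t
  map {s t} _ :=
    { toFun := fun x => ⟨if t ∈ J then (x : k) else 0, fun ht => if_neg ht⟩
      map_add' := by
        intro x y
        ext
        by_cases ht : t ∈ J <;> simp [ht]
      map_smul' := by
        intro c x
        ext
        by_cases ht : t ∈ J <;> simp [ht] }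
  map_refl t x := by
    ext
    by_cases ht : t ∈ J
    · simp [ht]
    · simp [ht, x.2 ht]
  map_trans {r s t} hrs hst x := by
    ext
    by_cases ht : t ∈ J
    · by_cases hs : s ∈ J
      · simp [ht, hs]
      · have hr : r ∉ J := fun hr => hs (hJ.out hr ht ⟨hrs, hst⟩)
        simp [ht, hs, x.2 hr]
    · simp [ht]

end PersistenceModule

/-! ## Barcodes -/

/-- The extended plane `ℝ × (ℝ ∪ {+∞})` in which the points of a barcode live. -/
abbrev BarPoint : Type := ℝ × WithTop ℝ

open Classical in
/-- The multiplicity function of `B ∪ Δ^∞`: the finite multiset `B` together with countably many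
copies of the diagonal. -/
def withDiagonal (B : Multiset BarPoint) (x : BarPoint) : ℕ∞ :=
  (B.count x : ℕ∞) + if x.2 = (x.1 : WithTop ℝ) then ⊤ else 0

/-- The set `Bar` of barcodes (persistence diagrams): multisets, given by their multiplicity
functions, of the form `B ∪ Δ^∞` with `B` a finite multiset in `ℝ × (ℝ ∪ {+∞})`. -/
def Bar : Type := {D : BarPoint → ℕ∞ // ∃ B : Multiset BarPoint, D = withDiagonal B}

/-- The barcode `B ∪ Δ^∞`. -/
def Bar.ofMultiset (B : Multiset BarPoint) : Bar := ⟨withDiagonal B, B, rfl⟩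

/-- A nonempty interval of `ℝ`, bounded below. -/
structure BarInterval where
  carrier : Set ℝ
  nonempty : carrier.Nonempty
  ordConnected : carrier.OrdConnected
  bddBelow : BddBelow carrier

open Classical in
/-- The point `(inf J, sup J)` that represents the interval `J`. -/
def BarInterval.point (J : BarInterval) : BarPoint :=
  (sInf J.carrier, if BddAbove J.carrier then ((sSup J.carrier : ℝ) : WithTop ℝ) else ⊤)

/-- `D` is the persistence diagram of `A`: the module `A` decomposes as a finite direct sum of
interval modules, and `D` is the multiset of the points of these intervals, together with `Δ^∞`. -/
def IsPersistenceDiagram {k : Type u} [Field k] (A : PersistenceModule.{u, w} k) (D : Bar) :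
    Prop :=
  ∃ (N : ℕ) (J : Fin N → BarInterval),
    A.IsIsomorphic (PersistenceModule.finiteDirectSum fun i =>
      PersistenceModule.intervalModule k (J i).carrier (J i).ordConnected) ∧
    D = Bar.ofMultiset (Finset.univ.val.map fun i => (J i).point)

/-! ## Ordered barcodes and the quotient maps -/

/-- The `2m + n` coordinates of an ordered barcode: `Sum.inl (i, 0)` and `Sum.inl (i, 1)` are the
two endpoints of the `i`-th finite bar, `Sum.inr j` is the left endpoint of the `j`-th infinite
bar. -/
abbrev BarIndex (m n : ℕ) : Type := (Fin m × Fin 2) ⊕ Fin n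

/-- The space `ℝ^{2m} × ℝ^n` of ordered barcodes, with its usual smooth structure. -/
abbrev OrderedBarcode (m n : ℕ) : Type := BarIndex m n → ℝ

/-- The quotient map `Q_{m,n} : ℝ^{2m} × ℝ^n → Bar`, which forgets the ordering of the bars. -/
def quotientMap (m n : ℕ) (z : OrderedBarcode m n) : Bar :=
  Bar.ofMultiset
    ((Finset.univ.val.map fun i : Fin m =>
        ((z (Sum.inl (i, 0)), ((z (Sum.inl (i, 1)) : ℝ) : WithTop ℝ)) : BarPoint)) +
      (Finset.univ.val.map fun j : Fin n => ((z (Sum.inr j), ⊤) : BarPoint)))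

/-- The coordinates of `∏_p ℝ^{2 m_p} × ℝ^{n_p}`, for `p = 0, …, d`. -/
abbrev TotalIndex {d : ℕ} (m n : Fin (d + 1) → ℕ) : Type := Σ p, BarIndex (m p) (n p)

/-- The component in `ℝ^{2 m_p} × ℝ^{n_p}` of a vector of `∏_p ℝ^{2 m_p} × ℝ^{n_p}`, as a
continuous linear map. -/
def component {d : ℕ} (m n : Fin (d + 1) → ℕ) (p : Fin (d + 1)) :
    (TotalIndex m n → ℝ) →L[ℝ] OrderedBarcode (m p) (n p) :=
  ContinuousLinearMap.pi fun i => ContinuousLinearMap.proj (⟨p, i⟩ : TotalIndex m n)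

/-- The product `Q = ∏_p Q_{m_p,n_p} : ∏_p ℝ^{2 m_p} × ℝ^{n_p} → Bar^{d+1}`. -/
def totalQuotientMap {d : ℕ} (m n : Fin (d + 1) → ℕ) (z : TotalIndex m n → ℝ) :
    Fin (d + 1) → Bar :=
  fun p => quotientMap (m p) (n p) (component m n p z)

/-- A permutation matrix, with rows indexed by `α` and columns indexed by `β`. -/
def IsPermutationMatrix {α β : Type*} [DecidableEq β] (P : Matrix α β ℝ) : Prop :=
  ∃ e : α ≃ β, P = e.toPEquiv.toMatrix

/-! ## Simplicial complexes, filter functions and persistent homology -/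

section Simplicial

variable {V : Type v} [LinearOrder V]

/-- The simplices of an abstract simplicial complex. -/
abbrev Simplex (K : PreAbstractSimplicialComplex V) : Type v := {σ : Finset V // σ ∈ K.faces}

/-- The dimension of a finite simplicial complex (`0` for the empty complex). -/
def complexDim (K : PreAbstractSimplicialComplex V) [Fintype (Simplex K)] : ℕ :=
  Finset.univ.sup fun σ : Simplex K => σ.1.card - 1

/-- Filter functions: functions on the simplices that are monotone for inclusion of faces. -/
def IsFilterFunction (K : PreAbstractSimplicialComplex V) (f : Simplex K → ℝ) : Prop :=
  ∀ σ τ : Simplex K, σ.1 ⊆ τ.1 → f σ ≤ f τ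

/-- Two functions on the simplices are ordering equivalent if they induce the same pre-order. -/
def OrderingEquivalent (K : PreAbstractSimplicialComplex V) (f g : Simplex K → ℝ) : Prop :=
  ∀ σ τ : Simplex K, f σ ≤ f τ ↔ g σ ≤ g τ

/-- The collection `Ω(ℝ^K)` of ordering equivalence classes, as subsets of `ℝ^K`. A class that
contains one filter function consists of filter functions. -/
def orderingClasses (K : PreAbstractSimplicialComplex V) : Set (Set (Simplex K → ℝ)) :=
  Set.range fun f => {g | OrderingEquivalent K f g}

variable (k : Type u) [Field k]

open Classical in
/-- The simplicial boundary operator, each simplex being oriented by the order of its vertices: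
`∂ [v₀, …, v_p] = ∑ i, (-1)^i [v₀, …, v̂_i, …, v_p]`, and `∂ [v₀] = 0`. -/
def boundary : (Finset V →₀ k) →ₗ[k] (Finset V →₀ k) :=
  Finsupp.linearCombination k fun σ : Finset V =>
    if σ.card ≤ 1 then 0
    else ∑ x ∈ σ, Finsupp.single (σ.erase x) ((-1 : k) ^ (σ.filter fun y => y < x).card)

/-- The simplicial `p`-chains of a family `A` of simplices. -/
def chains (A : Set (Finset V)) (p : ℕ) : Submodule k (Finset V →₀ k) :=
  Finsupp.supported k k {σ | σ ∈ A ∧ σ.card = p + 1}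

/-- The simplicial `p`-cycles of a complex with set of simplices `A`. -/
def cycles (A : Set (Finset V)) (p : ℕ) : Submodule k (Finset V →₀ k) :=
  chains k A p ⊓ LinearMap.ker (boundary k)

/-- The simplicial `p`-boundaries of a complex with set of simplices `A`. -/
def boundaries (A : Set (Finset V)) (p : ℕ) : Submodule k (Finset V →₀ k) :=
  (chains k A (p + 1)).map (boundary k)

/-- The simplicial homology `H_p = Z_p / B_p` with coefficients in `k` of a complex with set of
simplices `A`. -/
abbrev Homology (A : Set (Finset V)) (p : ℕ) : Type max u v :=
  (cycles k A p) ⧸ ((boundaries k A p).comap (cycles k A p).subtype)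

theorem chains_mono {A A' : Set (Finset V)} (h : A ⊆ A') (p : ℕ) :
    chains k A p ≤ chains k A' p :=
  Finsupp.supported_mono fun _ hσ => ⟨h hσ.1, hσ.2⟩

theorem cycles_mono {A A' : Set (Finset V)} (h : A ⊆ A') (p : ℕ) :
    cycles k A p ≤ cycles k A' p :=
  inf_le_inf_right _ (chains_mono k h p)

theorem boundaries_mono {A A' : Set (Finset V)} (h : A ⊆ A') (p : ℕ) :
    boundaries k A p ≤ boundaries k A' p :=
  Submodule.map_mono (chains_mono k h (p + 1))

/-- The map induced in homology by an inclusion of complexes. -/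
def homologyMap {A A' : Set (Finset V)} (h : A ⊆ A') (p : ℕ) :
    Homology k A p →ₗ[k] Homology k A' p :=
  Submodule.mapQ _ _ (Submodule.inclusion (cycles_mono k h p))
    (fun x hx => boundaries_mono k h p (show (x : Finset V →₀ k) ∈ boundaries k A p from hx))

/-- The simplices of the sublevel complex `K^t = {σ ∈ K | f σ ≤ t}`. -/
def sublevel (K : PreAbstractSimplicialComplex V) (f : Simplex K → ℝ) (t : ℝ) :
    Set (Finset V) :=
  {σ | ∃ h : σ ∈ K.faces, f ⟨σ, h⟩ ≤ t}

theorem sublevel_mono (K : PreAbstractSimplicialComplex V) (f : Simplex K → ℝ) {s t : ℝ}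
    (h : s ≤ t) : sublevel K f s ⊆ sublevel K f t :=
  fun _ ⟨hσ, hs⟩ => ⟨hσ, hs.trans h⟩

/-- The sublevel set persistent homology of `f` in degree `p`: the spaces `H_p(K^t)`, with the maps
induced by inclusions. -/
def persistentHomology (K : PreAbstractSimplicialComplex V) (f : Simplex K → ℝ) (p : ℕ) :
    PersistenceModule.{u, max u v} k where
  obj t := Homology k (sublevel K f t) p
  map h := homologyMap k (sublevel_mono K f h) p
  map_refl t x := by
    obtain ⟨y, rfl⟩ := Submodule.Quotient.mk_surjective _ x
    rfl
  map_trans hrs hst x := by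
    obtain ⟨y, rfl⟩ := Submodule.Quotient.mk_surjective _ x
    rfl

open Classical in
/-- The barcode map `Dgm_p`: it sends `f` to the persistence diagram of its sublevel set persistent
homology in degree `p` (by convention the diagonal `Δ^∞`, if there is none). -/
def dgm (K : PreAbstractSimplicialComplex V) (p : ℕ) (f : Simplex K → ℝ) : Bar :=
  if h : ∃ D, IsPersistenceDiagram (persistentHomology k K f p) D then h.choose
  else Bar.ofMultiset 0

/-- The full barcode map `Dgm = (Dgm_0, …, Dgm_d)`, where `d` is the dimension of `K`. -/
def fullDgm (K : PreAbstractSimplicialComplex V) [Fintype (Simplex K)] (f : Simplex K → ℝ) :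
    Fin (complexDim K + 1) → Bar :=
  fun p => dgm k K p f

end Simplicial

/-! ## Stratified manifolds -/

section Stratified

/-- Convergence of linear subspaces of `E` in the Grassmannian: the dimensions eventually agree, and
every vector of the limit is a limit of vectors of the subspaces. -/
def SubspaceTendsto {E : Type*} [NormedAddCommGroup E] [NormedSpace ℝ E]
    (A : ℕ → Submodule ℝ E) (L : Submodule ℝ E) : Prop :=
  (∀ᶠ i in atTop, Module.finrank ℝ (A i) = Module.finrank ℝ L) ∧
    ∀ a ∈ L, Tendsto (fun i => Metric.infDist a (A i : Set E)) atTop (𝓝 0)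

variable {E : Type*} [NormedAddCommGroup E] [NormedSpace ℝ E]
  {M : Type*} [TopologicalSpace M] [ChartedSpace E M]

/-- `S` is a smooth (embedded) submanifold of `M`: near each of its points it is, in a smooth chart
of `M`, an affine slice. -/
def IsSmoothSubmanifold (E : Type*) [NormedAddCommGroup E] [NormedSpace ℝ E]
    {M : Type*} [TopologicalSpace M] [ChartedSpace E M] (S : Set M) : Prop :=
  ∀ x ∈ S, ∃ φ ∈ IsManifold.maximalAtlas 𝓘(ℝ, E) ∞ M, x ∈ φ.source ∧
    ∃ L : Submodule ℝ E, φ '' (φ.source ∩ S) = {y ∈ φ.target | y - φ x ∈ L}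

/-- The tangent space at `y` of the submanifold `S`, in the coordinates of the chart `φ`. -/
def tangentInChart (φ : OpenPartialHomeomorph M E) (S : Set M) (y : M) : Submodule ℝ E :=
  Submodule.span ℝ (tangentConeAt ℝ (φ '' (φ.source ∩ S)) (φ y))

/-- Whitney's condition (b) for the pair `(S', S'')` at `x ∈ S'`, in local coordinates around `x`:
if `x'_i ∈ S'` and `x''_i ∈ S''` converge to `x`, the lines `(x'_i, x''_i)` converge to a line, and
the tangent spaces `T_{x''_i} S''` converge to a flat, then the flat contains the line. -/
def WhitneyConditionB (E : Type*) [NormedAddCommGroup E] [NormedSpace ℝ E]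
    {M : Type*} [TopologicalSpace M] [ChartedSpace E M] (S' S'' : Set M) (x : M) : Prop :=
  ∃ φ ∈ IsManifold.maximalAtlas 𝓘(ℝ, E) ∞ M, x ∈ φ.source ∧
    ∀ x' x'' : ℕ → M, (∀ i, x' i ∈ S') → (∀ i, x'' i ∈ S'') →
      Tendsto x' atTop (𝓝 x) → Tendsto x'' atTop (𝓝 x) → (∀ i, x' i ≠ x'' i) →
      ∀ l T : Submodule ℝ E, Module.finrank ℝ l = 1 →
        SubspaceTendsto (fun i => Submodule.span ℝ {φ (x'' i) - φ (x' i)}) l →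
        SubspaceTendsto (fun i => tangentInChart φ S'' (x'' i)) T →
        l ≤ T

/-- Whitney stratifications of the smooth manifold `M`. -/
structure IsWhitneyStratification (E : Type*) [NormedAddCommGroup E] [NormedSpace ℝ E]
    {M : Type*} [TopologicalSpace M] [ChartedSpace E M] (𝒮 : Set (Set M)) : Prop where
  connected : ∀ S ∈ 𝒮, IsConnected S
  submanifold : ∀ S ∈ 𝒮, IsSmoothSubmanifold E S
  partition : Setoid.IsPartition 𝒮
  locallyFinite : ∀ x : M, ∃ U : Set M, IsOpen U ∧ x ∈ U ∧ {S ∈ 𝒮 | (S ∩ U).Nonempty}.Finite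
  frontier : ∀ S ∈ 𝒮, ∃ T ⊆ 𝒮, closure S \ S = ⋃₀ T
  conditionB : ∀ S' ∈ 𝒮, ∀ S'' ∈ 𝒮, ∀ x ∈ S', WhitneyConditionB E S' S'' x

/-- A map is weakly stratified if the preimage of each stratum is a union of strata. -/
def IsWeaklyStratified {M N : Type*} (𝒮 : Set (Set M)) (𝒯 : Set (Set N)) (f : M → N) : Prop :=
  ∀ N' ∈ 𝒯, ∃ T ⊆ 𝒮, f ⁻¹' N' = ⋃₀ T

/-- `G` is a `C^r` local extension of `F|_S` at `x`, defined on the open neighbourhood `U` of `x`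
(the values of `G` outside of `U` are irrelevant). -/
def IsLocalExtension (E : Type*) [NormedAddCommGroup E] [NormedSpace ℝ E]
    {M : Type*} [TopologicalSpace M] [ChartedSpace E M]
    {W : Type*} [NormedAddCommGroup W] [NormedSpace ℝ W]
    (r : ℕ∞) (F : M → W) (S : Set M) (x : M) (U : Set M) (G : M → W) : Prop :=
  IsOpen U ∧ x ∈ U ∧ ContMDiffOn 𝓘(ℝ, E) 𝓘(ℝ, W) r G U ∧ ∀ y ∈ U ∩ S, G y = F y

/-- `L` is a directional derivative at `x` along `S` of the vector valued map `F`: the differential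
at `x` of a `C^r` local extension of `F|_S`. -/
def IsDirectionalDerivative
    {W : Type*} [NormedAddCommGroup W] [NormedSpace ℝ W]
    (r : ℕ∞) (F : M → W) (S : Set M) (x : M) (L : TangentSpace 𝓘(ℝ, E) x →L[ℝ] W) : Prop :=
  ∃ (U : Set M) (G : M → W), IsLocalExtension E r F S x U G ∧
    HasMFDerivAt 𝓘(ℝ, E) 𝓘(ℝ, W) G x L

/-- `B̃` is a `C^r` local lift of the barcode valued map `B` along `S`, defined on the open
neighbourhood `U` of `x`. -/
def IsLocalLiftAlong (E : Type*) [NormedAddCommGroup E] [NormedSpace ℝ E]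
    {M : Type*} [TopologicalSpace M] [ChartedSpace E M]
    (r : ℕ∞) (B : M → Bar) (S : Set M) (x : M) (U : Set M) (m n : ℕ)
    (Bt : M → OrderedBarcode m n) : Prop :=
  IsOpen U ∧ x ∈ U ∧ ContMDiffOn 𝓘(ℝ, E) 𝓘(ℝ, OrderedBarcode m n) r Bt U ∧
    ∀ y ∈ U ∩ S, B y = quotientMap m n (Bt y)

/-- The barcode valued map `B` is `r`-differentiable at `x` along `S`. -/
def BarDifferentiableAlong (E : Type*) [NormedAddCommGroup E] [NormedSpace ℝ E]
    {M : Type*} [TopologicalSpace M] [ChartedSpace E M]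
    (r : ℕ∞) (B : M → Bar) (S : Set M) (x : M) : Prop :=
  ∃ (U : Set M) (m n : ℕ) (Bt : M → OrderedBarcode m n), IsLocalLiftAlong E r B S x U m n Bt

/-- `L` is a directional derivative at `x` along `S` of the barcode valued map `B`: the differential
at `x` of a `C^r` local lift of `B` along `S`. -/
def IsBarDirectionalDerivative (r : ℕ∞) (B : M → Bar) (S : Set M) (x : M) (m n : ℕ)
    (L : TangentSpace 𝓘(ℝ, E) x →L[ℝ] OrderedBarcode m n) : Prop :=
  ∃ (U : Set M) (Bt : M → OrderedBarcode m n), IsLocalLiftAlong E r B S x U m n Bt ∧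
    HasMFDerivAt 𝓘(ℝ, E) 𝓘(ℝ, OrderedBarcode m n) Bt x L

end Stratified

end

/-! Over a field, a complex filtered by adding one basis vector at a time has a normal form: a
basis, triangular with respect to the given one, in which the differential sends every vector to
zero or to another basis vector, its partner. `exists_isNormalForm` constructs it by the reduction
that underlies the persistence algorithm. For a filter function `f`, the pre-order of `f` is refined
to a linear order `g` in which faces come first. Every sublevel complex is an initial segment of
`g`, so one normal form describes the cycles and boundaries of all of them at once, and persistent
homology splits into the bars `[f σ, f (p σ))` of pairs and `[f σ, ∞)` of unpaired simplices
(`IsNormalForm.isIsomorphic`).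

The pairing is determined by `g` alone, so it serves every function ordering equivalent to `f`.
Listing the simplices as first members of pairs, second members, and unpaired ones gives a bijection
`e` for which the lift is `f ∘ e` on the whole class (`IsFilterFunction.exists_pairing`). The
numbers of pairs and of unpaired simplices in degree `q` are the dimensions of the boundaries and of
the homology of `K`, hence the same for all `f`; this works because pairs of equal value are kept as
bars of length zero, which `Δ^∞` absorbs.

The diagram is well defined (`IsPersistenceDiagram.unique`) because the rank of the map from `s` to
`t` counts the bars containing both parameters, and alternating sums of such counts around a point
give its multiplicity.

Finally, a stratum is mapped into a single ordering class, where the lift is a fixed linear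
isomorphism applied to `F`. Composing with this isomorphism and with its inverse exchanges
extensions and derivatives of `F` with those of the lift, and projecting to degree `p` gives local
lifts of `B_p`. -/

/-! ## Normal forms of filtered complexes -/

section NormalForm

variable {k M ι α : Type*} [Field k] [AddCommGroup M] [Module k M] [LinearOrder α]

/-- The elements of `s` that have the same degree as `i` and do not come after `i`. -/
def lowerPart (g : ι → α) (deg : ι → ℕ) (s : Finset ι) (i : ι) : Set ι :=
  {j | j ∈ s ∧ g j ≤ g i ∧ deg j = deg i}

/-- The family `c` is triangular with respect to the family `e`. -/
def IsTriangular (k : Type*) {M ι α : Type*} [Field k] [AddCommGroup M] [Module k M]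
    [LinearOrder α] (g : ι → α) (deg : ι → ℕ) (s : Finset ι) (c e : ι → M) : Prop :=
  ∀ i ∈ s, c i ∈ Submodule.span k (e '' lowerPart g deg s i)

variable {g : ι → α} {deg : ι → ℕ} {s : Finset ι} {b c e : ι → M}

theorem lowerPart_subset {i j : ι} (h : j ∈ lowerPart g deg s i) :
    lowerPart g deg s j ⊆ lowerPart g deg s i :=
  fun _ hl => ⟨hl.1, hl.2.1.trans h.2.1, hl.2.2.trans h.2.2⟩

theorem lowerPart_mono {t : Finset ι} (hst : s ⊆ t) {i : ι} :
    lowerPart g deg s i ⊆ lowerPart g deg t i :=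
  fun _ hj => ⟨hst hj.1, hj.2⟩

theorem IsTriangular.span_le (h : IsTriangular k g deg s c e) (A : Set ι) (hA : A ⊆ s)
    (hlow : ∀ i ∈ A, lowerPart g deg s i ⊆ A) :
    Submodule.span k (c '' A) ≤ Submodule.span k (e '' A) := by
  rw [Submodule.span_le]
  rintro _ ⟨i, hi, rfl⟩
  exact Submodule.span_mono (image_mono (hlow i hi)) (h i (hA hi))

theorem IsTriangular.trans (h : IsTriangular k g deg s b c) (h' : IsTriangular k g deg s c e) :
    IsTriangular k g deg s b e := fun i hi =>
  h'.span_le _ (fun _ hj => hj.1) (fun _ hj => lowerPart_subset hj) (h i hi)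

theorem IsTriangular.mono {t : Finset ι} (h : IsTriangular k g deg s c e) (hst : s ⊆ t) {i : ι}
    (hi : i ∈ s) : c i ∈ Submodule.span k (e '' lowerPart g deg t i) :=
  Submodule.span_mono (image_mono (lowerPart_mono hst)) (h i hi)

/-- A pair of a basis `c` and an involution `p` such that the differential `∂` maps every basis
vector to zero or to its partner. -/
structure IsNormalForm (d : M →ₗ[k] M) (e : ι → M) (g : ι → α) (deg : ι → ℕ) (s : Finset ι)
    (c : ι → M) (p : ι → ι) : Prop where
  invol : ∀ i, p (p i) = i
  fix : ∀ i ∉ s, p i = i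
  deg_partner : ∀ i, g (p i) < g i → deg (p i) + 1 = deg i
  triangular : IsTriangular k g deg s c e
  triangular' : IsTriangular k g deg s e c
  map_eq : ∀ i ∈ s, d (c i) = if g (p i) < g i then c (p i) else 0

variable {d : M →ₗ[k] M} {p : ι → ι}

theorem IsNormalForm.partner_mem (h : IsNormalForm d e g deg s c p) {i : ι} (hi : i ∈ s) :
    p i ∈ s := by
  by_contra hp
  have := h.fix _ hp
  rw [h.invol] at this
  exact hp (this ▸ hi)

/-- Triangularity in both directions. It allows chains on an initial segment of the filtration to be
expressed in the normal basis. -/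
theorem IsNormalForm.span_eq (h : IsNormalForm d e g deg s c p) (A : Set ι) (hA : A ⊆ s)
    (hlow : ∀ i ∈ A, lowerPart g deg s i ⊆ A) :
    Submodule.span k (c '' A) = Submodule.span k (e '' A) :=
  le_antisymm (h.triangular.span_le A hA hlow) (h.triangular'.span_le A hA hlow)

/-- A dimension count: `c` spans the same space as the independent family `e`, with the same number
of vectors. -/
theorem IsNormalForm.linearIndepOn (h : IsNormalForm d e g deg s c p)
    (he : LinearIndependent k e) : LinearIndepOn k c (s : Set ι) := by
  have h1 := h.span_eq s subset_rfl (fun i _ j hj => hj.1)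
  have h2 : LinearIndepOn k e (s : Set ι) := he.linearIndepOn _
  rw [LinearIndepOn, linearIndependent_iff_card_eq_finrank_span] at h2 ⊢
  rw [h2, Set.finrank, Set.finrank]
  rw [Set.image_eq_range, Set.image_eq_range] at h1
  exact (congrArg (fun N : Submodule k M => Module.finrank k N) h1).symm

open Classical in
/-- Replacing an unpaired basis vector by a cycle with the same leading term. -/
theorem IsNormalForm.replace (h : IsNormalForm d e g deg s c p) {b : ι} (hb : b ∈ s) {w : M}
    (hpb : p b = b) (hw : d w = 0) {a : k} (ha : a ≠ 0)
    (hwc : w - a • c b ∈ Submodule.span k (c '' {j | j ∈ s ∧ g j < g b ∧ deg j = deg b})) :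
    IsNormalForm d e g deg s (Function.update c b w) p := by
  have hne : ∀ j, g j < g b → j ≠ b := by rintro j hj rfl; exact lt_irrefl _ hj
  have hsub : c '' {j | j ∈ s ∧ g j < g b ∧ deg j = deg b} ⊆
      Function.update c b w '' {j | j ∈ s ∧ g j < g b ∧ deg j = deg b} := by
    rintro _ ⟨j, hj, rfl⟩
    exact ⟨j, hj, Function.update_of_ne (hne j hj.2.1) _ _⟩
  have hlow : {j | j ∈ s ∧ g j < g b ∧ deg j = deg b} ⊆ lowerPart g deg s b :=
    fun j hj => ⟨hj.1, hj.2.1.le, hj.2.2⟩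
  have t1 : IsTriangular k g deg s (Function.update c b w) c := by
    intro i hi
    by_cases hib : i = b
    · subst hib
      rw [Function.update_self, ← sub_add_cancel w (a • c i)]
      exact add_mem (Submodule.span_mono (image_mono hlow) hwc)
        (Submodule.smul_mem _ _ (Submodule.subset_span ⟨i, ⟨hi, le_rfl, rfl⟩, rfl⟩))
    · rw [Function.update_of_ne hib]
      exact Submodule.subset_span ⟨i, ⟨hi, le_rfl, rfl⟩, rfl⟩
  have t2 : IsTriangular k g deg s c (Function.update c b w) := by
    intro i hi
    by_cases hib : i = b
    · subst hib
      have : c i = a⁻¹ • (w - (w - a • c i)) := by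
        rw [sub_sub_cancel, smul_smul, inv_mul_cancel₀ ha, one_smul]
      rw [this]
      refine Submodule.smul_mem _ _ (sub_mem (Submodule.subset_span ⟨i, ⟨hi, le_rfl, rfl⟩, ?_⟩) ?_)
      · exact Function.update_self _ _ _
      · exact Submodule.span_mono (hsub.trans (image_mono hlow)) hwc
    · exact Submodule.subset_span ⟨i, ⟨hi, le_rfl, rfl⟩, Function.update_of_ne hib _ _⟩
  refine ⟨h.invol, h.fix, h.deg_partner, t1.trans h.triangular, h.triangular'.trans t2, ?_⟩
  intro i hi
  by_cases hib : i = b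
  · subst hib
    simp [hpb, hw]
  -- As `b` is unpaired, `c b` is the boundary of no other basis vector, so changing it affects no
  -- other equation.
  · have : p i ≠ b := fun hp => hib (by rw [← h.invol i, hp, hpb])
    rw [Function.update_of_ne hib, Function.update_of_ne this, h.map_eq i hi]

open Classical in
-- The new vector comes last, so correcting it by any earlier vectors of the same degree keeps both
-- families triangular.
theorem IsNormalForm.insert_triangular (h : IsNormalForm d e g deg s c p) {a : ι} (ha : a ∉ s)
    (hmax : ∀ i ∈ s, g i ≤ g a) {y : M}
    (hy : y - e a ∈ Submodule.span k (e '' {j | j ∈ s ∧ deg j = deg a})) :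
    IsTriangular k g deg (insert a s) (Function.update c a y) e ∧
      IsTriangular k g deg (insert a s) e (Function.update c a y) := by
  have hne : ∀ i ∈ s, i ≠ a := by rintro i hi rfl; exact ha hi
  have hlow : {j | j ∈ s ∧ deg j = deg a} ⊆ lowerPart g deg (insert a s) a :=
    fun j hj => ⟨Finset.mem_insert_of_mem hj.1, hmax j hj.1, hj.2⟩
  have haa : a ∈ lowerPart g deg (insert a s) a := ⟨Finset.mem_insert_self _ _, le_rfl, rfl⟩
  have hc : ∀ A : Set ι, A ⊆ s → c '' A = Function.update c a y '' A := by
    intro A hA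
    exact image_congr fun i hi => (Function.update_of_ne (hne i (hA hi)) _ _).symm
  constructor
  · intro i hi
    rcases Finset.mem_insert.1 hi with rfl | hi
    · rw [Function.update_self, ← sub_add_cancel y (e i)]
      exact add_mem (Submodule.span_mono (image_mono hlow) hy)
        (Submodule.subset_span ⟨i, haa, rfl⟩)
    · rw [Function.update_of_ne (hne i hi)]
      exact h.triangular.mono (Finset.subset_insert _ _) hi
  · intro i hi
    rcases Finset.mem_insert.1 hi with rfl | hi
    · rw [← sub_sub_cancel y (e i)]
      refine sub_mem (Submodule.subset_span ⟨i, haa, Function.update_self _ _ _⟩) ?_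
      refine Submodule.span_mono (image_mono hlow) ?_
      rw [← hc _ fun j hj => hj.1, h.span_eq _ (fun j hj => hj.1)]
      · exact hy
      · exact fun j hj l hl => ⟨hl.1, hl.2.2.trans hj.2⟩
    · have := h.triangular' i hi
      rw [hc _ fun j hj => hj.1] at this
      exact Submodule.span_mono (image_mono (lowerPart_mono (Finset.subset_insert _ _))) this

open Classical in
/-- Adding a basis vector that is a cycle. -/
theorem IsNormalForm.insert_cycle (h : IsNormalForm d e g deg s c p) {a : ι} (ha : a ∉ s)
    (hmax : ∀ i ∈ s, g i ≤ g a) {y : M}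
    (hy : y - e a ∈ Submodule.span k (e '' {j | j ∈ s ∧ deg j = deg a})) (hd : d y = 0) :
    IsNormalForm d e g deg (insert a s) (Function.update c a y) p := by
  obtain ⟨t1, t2⟩ := h.insert_triangular ha hmax hy
  refine ⟨h.invol, fun i hi => h.fix i fun h' => hi (Finset.mem_insert_of_mem h'),
    h.deg_partner, t1, t2, ?_⟩
  intro i hi
  rcases Finset.mem_insert.1 hi with rfl | hi
  · simp [h.fix i ‹i ∉ s›, hd]
  · have h1 : i ≠ a := fun h' => ha (h' ▸ hi)
    have h2 : p i ≠ a := by rintro h2; exact ha (h2 ▸ h.partner_mem hi)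
    rw [Function.update_of_ne h1, Function.update_of_ne h2, h.map_eq i hi]

open Classical in
/-- Adding a basis vector whose boundary is an unpaired basis vector. -/
theorem IsNormalForm.insert_pair (h : IsNormalForm d e g deg s c p) {a b : ι} (ha : a ∉ s)
    (hmax : ∀ i ∈ s, g i ≤ g a) (hb : b ∈ s) (hba : g b < g a) (hpb : p b = b)
    (hdeg : deg b + 1 = deg a) {y : M}
    (hy : y - e a ∈ Submodule.span k (e '' {j | j ∈ s ∧ deg j = deg a})) (hd : d y = c b) :
    IsNormalForm d e g deg (insert a s) (Function.update c a y)
      (fun i => if i = a then b else if i = b then a else p i) := by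
  obtain ⟨t1, t2⟩ := h.insert_triangular ha hmax hy
  have hab : b ≠ a := by rintro rfl; exact ha hb
  have hpa := h.fix a ha
  have key : ∀ i, i ≠ a → i ≠ b → p i ≠ a ∧ p i ≠ b := fun i h1 h2 =>
    ⟨fun h' => h1 (by rw [← h.invol i, h', hpa]), fun h' => h2 (by rw [← h.invol i, h', hpb])⟩
  refine ⟨?_, ?_, ?_, t1, t2, ?_⟩
  · intro i
    by_cases h1 : i = a
    · simp [h1, hab]
    by_cases h2 : i = b
    · simp [h2, hab]
    simp [h1, h2, key i h1 h2, h.invol]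
  · intro i hi
    rw [Finset.mem_insert, not_or] at hi
    have h2 : i ≠ b := by rintro rfl; exact hi.2 hb
    simp [hi.1, h2, h.fix i hi.2]
  · intro i
    by_cases h1 : i = a
    · simp [h1, hdeg]
    by_cases h2 : i = b
    · simp only [h2, hab, if_false, if_true]
      exact fun h' => absurd h' hba.not_gt
    simpa [h1, h2] using h.deg_partner i
  · intro i hi
    rcases Finset.mem_insert.1 hi with rfl | hi
    · simp [hba, hd, hab]
    · have h1 : i ≠ a := fun h' => ha (h' ▸ hi)
      by_cases h2 : i = b
      · simp only [h2, hab, if_false, if_true, hba.not_gt]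
        rw [Function.update_of_ne hab, h.map_eq b hb, hpb, if_neg (lt_irrefl _)]
      · have h3 := (key i h1 h2).1
        simp only [h1, h2, if_false]
        rw [Function.update_of_ne h1, Function.update_of_ne h3, h.map_eq i hi]

/-- Induction along `g`. The boundary of the last vector `e a` is expanded in the normal basis of
the earlier ones. After `e a` is corrected by partners, only unpaired vectors remain in its
boundary. If none is left, the corrected vector is a new unpaired cycle; otherwise `a` is paired
with the latest of them. -/
theorem exists_isNormalForm (d : M →ₗ[k] M) {e : ι → M} (he : LinearIndependent k e) {g : ι → α}
    (hg : Function.Injective g) (deg : ι → ℕ) (s : Finset ι) (hdd : ∀ i, d (d (e i)) = 0)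
    (hd : ∀ i ∈ s, d (e i) ∈
      Submodule.span k (e '' {j | j ∈ s ∧ g j < g i ∧ deg j + 1 = deg i})) :
    ∃ c p, IsNormalForm d e g deg s c p := by
  classical
  induction s using Finset.induction_on_max_value g with
  | empty => exact ⟨e, id, by simp, by simp, by simp, by simp [IsTriangular],
      by simp [IsTriangular], by simp⟩
  | insert a s ha hmax ih =>
    have hlt : ∀ i ∈ s, g i < g a := fun i hi =>
      lt_of_le_of_ne (hmax i hi) fun h => ha (hg h ▸ hi)
    obtain ⟨c, p, h⟩ := ih fun i hi => by
      refine Submodule.span_mono (image_mono ?_) (hd i (Finset.mem_insert_of_mem hi))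
      rintro j ⟨hj, hji, hdj⟩
      refine ⟨(Finset.mem_insert.1 hj).resolve_left ?_, hji, hdj⟩
      rintro rfl
      exact (hji.trans (hlt i hi)).false
    set T : Finset ι := s.filter fun j => deg j + 1 = deg a with hT
    have hTs : ∀ j ∈ T, j ∈ s := fun j hj => (Finset.mem_filter.1 hj).1
    have hTd : ∀ j ∈ T, deg j + 1 = deg a := fun j hj => (Finset.mem_filter.1 hj).2
    have hx : d (e a) ∈ Submodule.span k (c '' (T : Set ι)) := by
      rw [h.span_eq _ hTs]
      · refine Submodule.span_mono (image_mono ?_) (hd a (Finset.mem_insert_self _ _))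
        rintro j ⟨hj, hja, hdj⟩
        refine Finset.mem_coe.2 (Finset.mem_filter.2 ⟨(Finset.mem_insert.1 hj).resolve_left ?_, hdj⟩)
        rintro rfl
        exact hja.false
      · intro i hi j hj
        exact Finset.mem_coe.2 (Finset.mem_filter.2 ⟨hj.1, hj.2.2 ▸ hTd i hi⟩)
    rw [Submodule.mem_span_image_finset_iff_exists_fun'] at hx
    obtain ⟨x, hx⟩ := hx
    have hli := h.linearIndepOn he
    -- the boundary of `e a` has no component along paired, later basis vectors
    have hneg : ∀ j ∈ T, g (p j) < g j → x j = 0 := by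
      -- Applying `d` to the expansion of `d (e a)` gives zero and leaves only these terms; the
      -- vectors `c (p j)` are independent because `p` is injective.
      have h0 : ∑ j ∈ T.filter (fun j => g (p j) < g j), x j • c (p j) = 0 := by
        have hda := hdd a
        rw [← hx, map_sum] at hda
        rw [Finset.sum_filter]
        refine (Finset.sum_congr rfl fun j hj => ?_).trans hda
        rw [map_smul, h.map_eq j (hTs j hj)]
        split_ifs <;> simp
      have h1 : LinearIndepOn k (fun j => c (p j)) ((T.filter fun j => g (p j) < g j) : Set ι) := by
        refine LinearIndepOn.comp_of_image (f := p) ?_ (fun i _ j _ hij => ?_)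
        · refine hli.mono ?_
          rintro _ ⟨j, hj, rfl⟩
          exact h.partner_mem (hTs j (Finset.mem_filter.1 hj).1)
        · rw [← h.invol i, hij, h.invol]
      rw [linearIndepOn_finset_iff] at h1
      intro j hj hpj
      exact h1 x h0 j (Finset.mem_filter.2 ⟨hj, hpj⟩)
    -- Here `c (p j)` has boundary `c j`, so subtracting these terms removes every paired vector
    -- from `d (e a)`.
    set y : M := e a - ∑ j ∈ T.filter (fun j => g j < g (p j)), x j • c (p j) with hy
    have hye : y - e a ∈ Submodule.span k (e '' {j | j ∈ s ∧ deg j = deg a}) := by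
      rw [← h.span_eq {j | j ∈ s ∧ deg j = deg a} (fun j hj => hj.1)
        (fun j hj l hl => ⟨hl.1, hl.2.2.trans hj.2⟩), hy, sub_sub_cancel_left]
      refine neg_mem (sum_mem fun j hj => Submodule.smul_mem _ _ (Submodule.subset_span ?_))
      obtain ⟨hjT, hjp⟩ := Finset.mem_filter.1 hj
      refine ⟨p j, ⟨h.partner_mem (hTs j hjT), ?_⟩, rfl⟩
      rw [← hTd j hjT, ← h.deg_partner (p j) (by rwa [h.invol]), h.invol]
    set U : Finset ι := T.filter fun j => p j = j ∧ x j ≠ 0 with hU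
    have hdy : d y = ∑ j ∈ U, x j • c j := by
      rw [hy, hU, map_sub, map_sum, ← hx, Finset.sum_filter (s := T), Finset.sum_filter (s := T),
        ← Finset.sum_sub_distrib]
      refine Finset.sum_congr rfl fun j hj => ?_
      by_cases hxj : x j = 0
      · simp [hxj]
      have h1 : ¬ g (p j) < g j := fun h' => hxj (hneg j hj h')
      rcases (not_lt.1 h1).lt_or_eq with h2 | h2
      · have h3 : p j ≠ j := fun h' => by rw [h'] at h2; exact h2.false
        rw [if_pos h2, if_neg (fun h' => h3 h'.1), map_smul,
          h.map_eq _ (h.partner_mem (hTs j hj)), h.invol, if_pos h2, sub_self]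
      · rw [if_neg h2.not_lt, if_pos ⟨(hg h2).symm, hxj⟩, sub_zero]
    rcases U.eq_empty_or_nonempty with hU0 | hU0
    · rw [hU0, Finset.sum_empty] at hdy
      exact ⟨_, _, h.insert_cycle ha hmax hye hdy⟩
    -- With `b` the latest index, `d y` is `x b • c b` plus earlier terms, so the cycle `d y` may
    -- replace `c b` and become exactly the boundary of `y`.
    · obtain ⟨b, hbU, hbmax⟩ := U.exists_max_image g hU0
      obtain ⟨hbT, hpb, hxb⟩ := Finset.mem_filter.1 hbU
      have h' := h.replace (hTs b hbT) (w := d y) (a := x b) hpb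
        (by
          rw [hdy, map_sum]
          refine Finset.sum_eq_zero fun j hj => ?_
          obtain ⟨hjT, hpj, -⟩ := Finset.mem_filter.1 hj
          rw [map_smul, h.map_eq j (hTs j hjT), hpj, if_neg (lt_irrefl _), smul_zero])
        hxb
        (by
          rw [hdy, ← Finset.sum_erase_eq_sub hbU]
          refine sum_mem fun j hj => Submodule.smul_mem _ _ (Submodule.subset_span ⟨j, ?_, rfl⟩)
          obtain ⟨hjb, hjU⟩ := Finset.mem_erase.1 hj
          have hjT := (Finset.mem_filter.1 hjU).1
          refine ⟨hTs j hjT, lt_of_le_of_ne (hbmax j hjU) fun h' => hjb (hg h'), ?_⟩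
          have h1 := hTd j hjT
          have h2 := hTd b hbT
          omega)
      exact ⟨_, _, h'.insert_pair ha hmax (hTs b hbT) (hlt b (hTs b hbT)) hpb (hTd b hbT) hye
        (Function.update_self (f := c) b (d y)).symm⟩

end NormalForm

/-! ### Cycles and boundaries in terms of a normal form -/

section NormalFormCycles

variable {k M ι α : Type*} [Field k] [AddCommGroup M] [Module k M] [LinearOrder α]

/-- Over a field the embedding of the span has a linear left inverse, so coordinates extend to all
of `M` even where `c` does not span. -/
theorem LinearIndependent.exists_coordinates [DecidableEq ι] {c : ι → M}
    (hc : LinearIndependent k c) :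
    ∃ φ : M →ₗ[k] (ι → k), ∀ i, φ (c i) = Pi.single i 1 := by
  obtain ⟨L, hL⟩ := (Finsupp.linearCombination k c).exists_leftInverse_of_injective
    (LinearMap.ker_eq_bot.2 hc)
  refine ⟨Finsupp.lcoeFun ∘ₗ L, fun i => ?_⟩
  have h1 := LinearMap.congr_fun hL (Finsupp.single i 1)
  simp only [LinearMap.comp_apply, Finsupp.linearCombination_single, one_smul,
    LinearMap.id_apply] at h1
  simp [h1, Finsupp.lcoeFun, Finsupp.single_eq_pi_single]

variable {c : ι → M} {φ : M →ₗ[k] (ι → k)}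

theorem coordinate_eq_zero [DecidableEq ι] (hφ : ∀ i, φ (c i) = Pi.single i 1) {T : Set ι} {x : M}
    (hx : x ∈ Submodule.span k (c '' T)) {i : ι} (hi : i ∉ T) : φ x i = 0 := by
  induction hx using Submodule.span_induction with
  | mem x h =>
    obtain ⟨j, hj, rfl⟩ := h
    rw [hφ, Pi.single_eq_of_ne]
    rintro rfl
    exact hi hj
  | zero => simp
  | add x y _ _ hx hy => simp [hx, hy]
  | smul a x _ hx => simp [hx]

theorem sum_coordinates [Fintype ι] [DecidableEq ι] (hφ : ∀ i, φ (c i) = Pi.single i 1) {T : Set ι} {x : M}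
    (hx : x ∈ Submodule.span k (c '' T)) : ∑ i, φ x i • c i = x := by
  induction hx using Submodule.span_induction with
  | mem x h =>
    obtain ⟨j, hj, rfl⟩ := h
    rw [Finset.sum_eq_single j, hφ, Pi.single_eq_same, one_smul]
    · intro i _ hij
      rw [hφ, Pi.single_eq_of_ne hij, zero_smul]
    · simp
  | zero => simp
  | add x y _ _ hx hy => simp [add_smul, Finset.sum_add_distrib, hx, hy]
  | smul a x _ hx => simp [mul_smul, ← Finset.smul_sum, hx]

theorem mem_span_of_coordinates [Fintype ι] [DecidableEq ι] (hφ : ∀ i, φ (c i) = Pi.single i 1) {T T' : Set ι} {x : M}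
    (hx : x ∈ Submodule.span k (c '' T)) (h : ∀ i ∈ T, φ x i ≠ 0 → i ∈ T') :
    x ∈ Submodule.span k (c '' T') := by
  rw [← sum_coordinates hφ hx]
  refine sum_mem fun i _ => ?_
  by_cases hi : φ x i = 0
  · simp [hi]
  · refine Submodule.smul_mem _ _ (Submodule.subset_span ⟨i, h i ?_ hi, rfl⟩)
    by_contra hT
    exact hi (coordinate_eq_zero hφ hx hT)

variable {d : M →ₗ[k] M} {e : ι → M} {g : ι → α} {deg : ι → ℕ} {p : ι → ι}

/-- Distinct basis vectors with nonzero boundary have distinct basis vectors as boundaries. No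
cancellation is possible, so a cycle involves none of them. -/
theorem IsNormalForm.span_inf_ker [Fintype ι] [DecidableEq ι]
    (h : IsNormalForm d e g deg Finset.univ c p)
    (hφ : ∀ i, φ (c i) = Pi.single i 1) (T : Set ι) :
    Submodule.span k (c '' T) ⊓ LinearMap.ker d =
      Submodule.span k (c '' {i | i ∈ T ∧ g i ≤ g (p i)}) := by
  apply le_antisymm
  · rintro x ⟨hx, hdx⟩
    refine mem_span_of_coordinates hφ hx fun i hi hxi => ⟨hi, ?_⟩
    by_contra hlt
    have h1 : d x = 0 := hdx
    rw [← sum_coordinates hφ hx, map_sum] at h1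
    apply hxi
    -- Only `c i` can contribute to the coordinate of `d x` at `p i`.
    have h2 := congrFun (congrArg φ h1) (p i)
    rw [map_sum, Finset.sum_apply, Finset.sum_eq_single i] at h2
    · simpa [h.map_eq i (Finset.mem_univ i), not_le.1 hlt, hφ] using h2
    · intro j _ hj
      rw [map_smul, h.map_eq j (Finset.mem_univ j)]
      split_ifs
      · rw [map_smul, hφ, Pi.smul_apply, Pi.single_eq_of_ne, smul_zero]
        exact fun h' => hj (by rw [← h.invol j, ← h', h.invol])
      · simp
    · simp
  · rw [Submodule.span_le]
    rintro _ ⟨i, ⟨hi, hp⟩, rfl⟩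
    refine ⟨Submodule.subset_span ⟨i, hi, rfl⟩, ?_⟩
    rw [SetLike.mem_coe, LinearMap.mem_ker, h.map_eq i (Finset.mem_univ i), if_neg hp.not_gt]

theorem IsNormalForm.map_span [Fintype ι] (h : IsNormalForm d e g deg Finset.univ c p) (T : Set ι) :
    (Submodule.span k (c '' T)).map d =
      Submodule.span k (c '' {i | p i ∈ T ∧ g i < g (p i)}) := by
  rw [Submodule.map_span]
  apply le_antisymm <;> rw [Submodule.span_le]
  · rintro _ ⟨_, ⟨i, hi, rfl⟩, rfl⟩
    rw [h.map_eq i (Finset.mem_univ i)]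
    split_ifs with hp
    · refine Submodule.subset_span ⟨p i, ?_, rfl⟩
      simp only [mem_ofPred_eq, h.invol]
      exact ⟨hi, hp⟩
    · exact zero_mem _
  · rintro _ ⟨i, ⟨hi, hp⟩, rfl⟩
    refine Submodule.subset_span ⟨c (p i), ⟨p i, hi, rfl⟩, ?_⟩
    rw [h.map_eq _ (Finset.mem_univ _), h.invol, if_pos hp]

end NormalFormCycles

/-! ## The simplicial boundary -/

section Boundary

variable {V : Type v} [LinearOrder V] (k : Type u) [Field k]

theorem boundary_single (σ : Finset V) : boundary k (Finsupp.single σ 1) =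
    if σ.card ≤ 1 then 0
    else ∑ x ∈ σ, Finsupp.single (σ.erase x) ((-1 : k) ^ (σ.filter fun y => y < x).card) := by
  rw [boundary, Finsupp.linearCombination_single, one_smul]

/-- Removing the smaller vertex `x` lowers the position of `y` by one, whereas removing `y` leaves
the position of `x` unchanged. -/
theorem boundary_sign {σ : Finset V} {x y : V} (hx : x ∈ σ) (hxy : x < y) :
    (-1 : k) ^ (σ.filter fun z => z < x).card * (-1) ^ ((σ.erase x).filter fun z => z < y).card +
      (-1) ^ (σ.filter fun z => z < y).card *
        (-1) ^ ((σ.erase y).filter fun z => z < x).card = 0 := by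
  have h1 : (σ.erase x).filter (fun z => z < y) = (σ.filter fun z => z < y).erase x := by
    ext z; simp [and_assoc]
  have h2 : (σ.erase y).filter (fun z => z < x) = σ.filter fun z => z < x := by
    ext z
    simp only [Finset.mem_filter, Finset.mem_erase]
    exact ⟨fun h => ⟨h.1.2, h.2⟩, fun h => ⟨⟨(h.2.trans hxy).ne, h.1⟩, h.2⟩⟩
  have h3 : x ∈ σ.filter fun z => z < y := Finset.mem_filter.2 ⟨hx, hxy⟩
  rw [h1, h2, ← Finset.card_erase_add_one h3, pow_succ]
  ring

/-- Terms cancel in pairs: the two orders of removing the same two vertices have opposite signs. -/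
theorem boundary_boundary_single (σ : Finset V) :
    boundary k (boundary k (Finsupp.single σ 1)) = 0 := by
  have hs : ∀ (τ : Finset V) (a : k), Finsupp.single τ a = a • Finsupp.single τ 1 := by simp
  rw [boundary_single]
  split_ifs with h1
  · exact map_zero _
  rw [map_sum]
  -- An edge needs a separate case: its faces are vertices, whose boundary is zero by convention
  -- rather than the empty face.
  have h2 : ∀ x ∈ σ, boundary k (Finsupp.single (σ.erase x)
      ((-1 : k) ^ (σ.filter fun y => y < x).card)) =
      if σ.card ≤ 2 then 0 else ∑ y ∈ σ.erase x, Finsupp.single ((σ.erase x).erase y)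
        ((-1 : k) ^ (σ.filter fun z => z < x).card *
          (-1) ^ ((σ.erase x).filter fun z => z < y).card) := by
    intro x hx
    rw [hs, map_smul, boundary_single, Finset.card_erase_of_mem hx]
    by_cases h3 : σ.card ≤ 2
    · rw [if_pos h3, if_pos (by omega), smul_zero]
    · rw [if_neg h3, if_neg (by omega), Finset.smul_sum]
      simp
  rw [Finset.sum_congr rfl h2]
  split_ifs
  · simp
  rw [Finset.sum_sigma']
  refine Finset.sum_involution (fun a _ => ⟨a.2, a.1⟩) ?_ ?_ ?_ ?_
  · rintro ⟨x, y⟩ h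
    obtain ⟨hx, hy⟩ := Finset.mem_sigma.1 h
    obtain ⟨hyx, hy⟩ := Finset.mem_erase.1 hy
    simp only at hx hy hyx
    rw [Finset.erase_right_comm, ← Finsupp.single_add, Finsupp.single_eq_zero]
    rcases lt_or_gt_of_ne hyx with h | h
    · rw [add_comm]; exact boundary_sign k hy h
    · exact boundary_sign k hx h
  · rintro ⟨x, y⟩ h - h'
    have := (Finset.mem_erase.1 (Finset.mem_sigma.1 h).2).1
    simp only [Sigma.mk.injEq] at h'
    exact this h'.1
  · rintro ⟨x, y⟩ h
    obtain ⟨hx, hy⟩ := Finset.mem_sigma.1 h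
    obtain ⟨hyx, hy⟩ := Finset.mem_erase.1 hy
    exact Finset.mem_sigma.2 ⟨hy, Finset.mem_erase.2 ⟨hyx.symm, hx⟩⟩
  · intro a h
    rfl

end Boundary

/-! ## Normal forms of filtered simplicial complexes -/

section Simplicial

variable {V : Type v} {K : PreAbstractSimplicialComplex V}
  (k : Type u) [Field k] {α : Type*} [LinearOrder α]

/-- The chain that consists of one simplex. -/
noncomputable def simplexChain (σ : Simplex K) : Finset V →₀ k := Finsupp.single σ.1 1

theorem linearIndependent_simplexChain :
    LinearIndependent k (simplexChain k : Simplex K → Finset V →₀ k) :=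
  (Finsupp.basisSingleOne.linearIndependent.comp _ Subtype.val_injective :
    LinearIndependent k (Finsupp.basisSingleOne ∘ (Subtype.val : Simplex K → Finset V)))

variable [LinearOrder V]

theorem erase_mem_faces {σ : Finset V} (hσ : σ ∈ K.faces) (hc : ¬ σ.card ≤ 1) {x : V}
    (hx : x ∈ σ) : σ.erase x ∈ K.faces := by
  refine (K.isRelLowerSet_faces hσ).2 (Finset.erase_subset x σ) (Finset.card_pos.1 ?_)
  rw [Finset.card_erase_of_mem hx]
  omega

theorem exists_simplicial_normalForm [Fintype (Simplex K)] {g : Simplex K → α}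
    (hg : Function.Injective g) (hmono : ∀ σ τ : Simplex K, σ.1 ⊂ τ.1 → g σ < g τ) :
    ∃ c p, IsNormalForm (boundary k) (simplexChain k) g (fun σ : Simplex K => σ.1.card)
      Finset.univ c p := by
  refine exists_isNormalForm _ (linearIndependent_simplexChain k) hg _ _
    (fun σ => boundary_boundary_single k σ.1) fun σ _ => ?_
  rw [simplexChain, boundary_single]
  split_ifs with h
  · exact zero_mem _
  refine sum_mem fun x hx => ?_
  have : ∀ a : k, Finsupp.single (σ.1.erase x) a =
    a • simplexChain k ⟨σ.1.erase x, erase_mem_faces σ.2 h hx⟩ := by simp [simplexChain]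
  rw [this]
  refine Submodule.smul_mem _ _ (Submodule.subset_span ⟨_, ⟨Finset.mem_univ _, ?_, ?_⟩, rfl⟩)
  · exact hmono _ _ (Finset.erase_ssubset hx)
  · exact Finset.card_erase_add_one hx

variable {k} [Fintype (Simplex K)] {g : Simplex K → α} {c : Simplex K → Finset V →₀ k}
  {p : Simplex K → Simplex K} {A : Set (Finset V)}

/-- `A` is an initial segment of `g`, so `span_eq` applies in each degree. The basis `c` does not
depend on `A`, hence it is adapted to all sublevel complexes simultaneously. -/
theorem IsNormalForm.chains_eq
    (h : IsNormalForm (boundary k) (simplexChain k) g (fun σ : Simplex K => σ.1.card)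
      Finset.univ c p) (hA : A ⊆ K.faces)
    (hlow : ∀ σ τ : Simplex K, g σ ≤ g τ → τ.1 ∈ A → σ.1 ∈ A) (q : ℕ) :
    chains k A q = Submodule.span k (c '' {σ | σ.1 ∈ A ∧ σ.1.card = q + 1}) := by
  rw [h.span_eq {σ | σ.1 ∈ A ∧ σ.1.card = q + 1}
    (fun _ _ => Finset.mem_coe.2 (Finset.mem_univ _))
    (fun i hi j hj => ⟨hlow _ _ hj.2.1 hi.1, hj.2.2.trans hi.2⟩), chains,
    Finsupp.supported_eq_span_single]
  congr 1
  ext x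
  constructor
  · rintro ⟨σ, hσ, rfl⟩
    exact ⟨⟨σ, hA hσ.1⟩, hσ, rfl⟩
  · rintro ⟨σ, hσ, rfl⟩
    exact ⟨σ.1, hσ, rfl⟩

theorem IsNormalForm.linearIndependent
    (h : IsNormalForm (boundary k) (simplexChain k) g (fun σ : Simplex K => σ.1.card)
      Finset.univ c p) : LinearIndependent k c := by
  have := h.linearIndepOn (linearIndependent_simplexChain k)
  rwa [Finset.coe_univ, linearIndepOn_univ_iff] at this

theorem IsNormalForm.cycles_eq
    (h : IsNormalForm (boundary k) (simplexChain k) g (fun σ : Simplex K => σ.1.card)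
      Finset.univ c p) (hA : A ⊆ K.faces)
    (hlow : ∀ σ τ : Simplex K, g σ ≤ g τ → τ.1 ∈ A → σ.1 ∈ A) (q : ℕ) :
    cycles k A q =
      Submodule.span k (c '' {σ | (σ.1 ∈ A ∧ σ.1.card = q + 1) ∧ g σ ≤ g (p σ)}) := by
  classical
  obtain ⟨φ, hφ⟩ := h.linearIndependent.exists_coordinates
  rw [cycles, h.chains_eq hA hlow, h.span_inf_ker hφ]
  rfl

theorem IsNormalForm.boundaries_eq
    (h : IsNormalForm (boundary k) (simplexChain k) g (fun σ : Simplex K => σ.1.card)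
      Finset.univ c p) (hA : A ⊆ K.faces)
    (hlow : ∀ σ τ : Simplex K, g σ ≤ g τ → τ.1 ∈ A → σ.1 ∈ A) (q : ℕ) :
    boundaries k A q =
      Submodule.span k (c '' {σ | ((p σ).1 ∈ A ∧ σ.1.card = q + 1) ∧ g σ < g (p σ)}) := by
  rw [boundaries, h.chains_eq hA hlow, h.map_span]
  congr 2
  ext σ
  simp only [mem_ofPred_eq]
  refine and_congr_left fun hlt => and_congr_right fun _ => ?_
  -- The later member of a pair has exactly one more vertex, which accounts for the shift from
  -- chains in degree `q + 1`.
  have := h.deg_partner (p σ) (by rwa [h.invol])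
  rw [h.invol] at this
  omega

theorem finrank_span_image_eq {ι M : Type*} [Fintype ι] [AddCommGroup M] [Module k M]
    {c : ι → M} (hc : LinearIndependent k c) (P : ι → Prop) [DecidablePred P] :
    Module.finrank k (Submodule.span k (c '' {i | P i})) = Fintype.card {i // P i} := by
  rw [Set.image_eq_range]
  exact finrank_span_eq_card (hc.comp _ Subtype.val_injective)

/-- The number of finite bars in degree `q`, including those of length zero. -/
noncomputable def numFinite (k : Type u) [Field k] (K : PreAbstractSimplicialComplex V) (q : ℕ) : ℕ :=
  Module.finrank k (boundaries k K.faces q)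

/-- The number of infinite bars in degree `q`. -/
noncomputable def numInfinite (k : Type u) [Field k] (K : PreAbstractSimplicialComplex V) (q : ℕ) :
    ℕ :=
  Module.finrank k (cycles k K.faces q) - Module.finrank k (boundaries k K.faces q)

open Classical in
-- The first members of pairs index a basis of the boundaries of `K`; the count is therefore
-- independent of the order `g` and of the normal form.
theorem IsNormalForm.card_finite
    (h : IsNormalForm (boundary k) (simplexChain k) g (fun σ : Simplex K => σ.1.card)
      Finset.univ c p) (q : ℕ) :
    Fintype.card {σ : Simplex K // σ.1.card = q + 1 ∧ g σ < g (p σ)} = numFinite k K q := by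
  rw [numFinite, h.boundaries_eq subset_rfl (fun σ _ _ _ => σ.2), finrank_span_image_eq
    h.linearIndependent]
  exact Fintype.card_congr (Equiv.subtypeEquivRight fun σ => by simp [(p σ).2])

open Classical in
-- Cycles are indexed by first members of pairs together with unpaired simplices, and the former
-- already index the boundaries.
theorem IsNormalForm.card_infinite
    (h : IsNormalForm (boundary k) (simplexChain k) g (fun σ : Simplex K => σ.1.card)
      Finset.univ c p) (hg : Function.Injective g) (q : ℕ) :
    Fintype.card {σ : Simplex K // σ.1.card = q + 1 ∧ p σ = σ} = numInfinite k K q := by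
  rw [numInfinite, ← numFinite, ← h.card_finite, h.cycles_eq subset_rfl (fun σ _ _ _ => σ.2),
    finrank_span_image_eq h.linearIndependent, Fintype.card_subtype, Fintype.card_subtype,
    Fintype.card_subtype, ← Finset.card_sdiff_of_subset]
  · congr 1
    ext σ
    simp only [Finset.mem_filter, Finset.mem_univ, true_and, Finset.mem_sdiff, σ.2]
    constructor
    · rintro ⟨h1, h2⟩
      simp [h1, h2]
    · rintro ⟨⟨h1, h2⟩, h3⟩
      refine ⟨h1, (hg (le_antisymm h2 (not_lt.1 fun h4 => h3 ⟨h1, h4⟩))).symm⟩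
  · intro σ
    simp only [Finset.mem_filter, Finset.mem_univ, true_and, σ.2]
    exact fun h => ⟨h.1, h.2.le⟩

end Simplicial

/-! ## The interval decomposition given by a normal form -/

theorem withDiagonal_add_eq {B C : Multiset BarPoint}
    (hC : ∀ x ∈ C, x.2 = (x.1 : WithTop ℝ)) : withDiagonal (B + C) = withDiagonal B := by
  funext x
  unfold withDiagonal
  by_cases hx : x.2 = (x.1 : WithTop ℝ)
  · simp [hx]
  · rw [Multiset.count_add, Multiset.count_eq_zero.2 fun h => hx (hC x h), add_zero]

theorem Bar.ofMultiset_eq_iff {B C : Multiset BarPoint} :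
    Bar.ofMultiset B = Bar.ofMultiset C ↔ withDiagonal B = withDiagonal C :=
  Subtype.ext_iff

theorem Bar.ofMultiset_map_filter {ι : Type*} (s : Finset ι) (P : ι → Prop) [DecidablePred P]
    (f : ι → BarPoint) (h : ∀ i ∈ s, ¬ P i → (f i).2 = ((f i).1 : WithTop ℝ)) :
    Bar.ofMultiset ((s.filter P).val.map f) = Bar.ofMultiset (s.val.map f) := by
  have h1 : s.val.map f = (s.filter P).val.map f + (s.filter fun i => ¬ P i).val.map f := by
    rw [← Multiset.map_add, Finset.filter_val, Finset.filter_val, Multiset.filter_add_not]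
  rw [Bar.ofMultiset_eq_iff, h1, withDiagonal_add_eq]
  intro x hx
  obtain ⟨i, hi, rfl⟩ := Multiset.mem_map.1 hx
  obtain ⟨hi, hP⟩ := Finset.mem_filter.1 hi
  exact h i hi hP

theorem Multiset.map_univ_equiv_subtype {ι κ β : Type*} [Fintype ι] [Fintype κ] (P : κ → Prop)
    [DecidablePred P] (e : ι ≃ {x // P x}) (f : κ → β) :
    (Finset.univ.val.map fun i => f (e i)) = (Finset.univ.filter P).val.map f := by
  have h : (Finset.univ.filter P).val = (Finset.univ.val.map fun i => ((e i : {x // P x}) : κ)) := by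
    have := Finset.map_val (e.toEmbedding.trans (Function.Embedding.subtype P)) Finset.univ
    rw [show (Finset.univ.val.map fun i => ((e i : {x // P x}) : κ)) = _ from this.symm]
    congr 1
    ext x
    simp only [Finset.mem_filter, Finset.mem_univ, true_and, Finset.mem_map,
      Function.Embedding.trans_apply, Equiv.coe_toEmbedding, Function.Embedding.subtype_apply]
    exact ⟨fun hx => ⟨e.symm ⟨x, hx⟩, by simp⟩, fun ⟨i, hi⟩ => hi ▸ (e i).2⟩
  rw [h, Multiset.map_map]
  rfl

section Decomposition

variable {ι α : Type*} [LinearOrder α]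

open Classical in
/-- The bar of the unpaired or first element `i` of a pair. -/
noncomputable def barSet (f : ι → ℝ) (g : ι → α) (p : ι → ι) (i : ι) : Set ℝ :=
  if g i < g (p i) then Ico (f i) (f (p i)) else Ici (f i)

open Classical in
/-- The point that represents `barSet f g p i`. -/
noncomputable def barPair (f : ι → ℝ) (g : ι → α) (p : ι → ι) (i : ι) : BarPoint :=
  (f i, if g i < g (p i) then ((f (p i) : ℝ) : WithTop ℝ) else ⊤)

variable {f : ι → ℝ} {g : ι → α} {p : ι → ι} {i : ι}

theorem mem_barSet {t : ℝ} :
    t ∈ barSet f g p i ↔ f i ≤ t ∧ ¬ (g i < g (p i) ∧ f (p i) ≤ t) := by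
  unfold barSet
  split_ifs with h <;> simp [h]

theorem ordConnected_barSet : (barSet f g p i).OrdConnected := by
  unfold barSet
  split_ifs
  · exact ordConnected_Ico
  · exact ordConnected_Ici

theorem bddBelow_barSet : BddBelow (barSet f g p i) :=
  ⟨f i, fun _ ht => (mem_barSet.1 ht).1⟩

/-- A nonempty `barSet` as an interval. -/
noncomputable def barInterval (f : ι → ℝ) (g : ι → α) (p : ι → ι) (i : ι)
    (h : (barSet f g p i).Nonempty) : BarInterval :=
  ⟨barSet f g p i, h, ordConnected_barSet, bddBelow_barSet⟩

theorem barInterval_point (h : (barSet f g p i).Nonempty) :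
    (barInterval f g p i h).point = barPair f g p i := by
  unfold BarInterval.point barPair barInterval
  by_cases h1 : g i < g (p i)
  · have h2 : barSet f g p i = Ico (f i) (f (p i)) := if_pos h1
    have h3 : f i < f (p i) := nonempty_Ico.1 (h2 ▸ h)
    have h4 : BddAbove (barSet f g p i) := h2 ▸ bddAbove_Ico
    simp only [if_pos h4, if_pos h1, h2, csInf_Ico h3, csSup_Ico h3]
  · have h2 : barSet f g p i = Ici (f i) := if_neg h1
    have h4 : ¬ BddAbove (barSet f g p i) := h2 ▸ not_bddAbove_Ici _
    simp only [if_neg h4, if_neg h1, h2, csInf_Ici]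

/-- An empty bar comes from a pair on which `f` takes equal values, so discarding it does not change
the barcode. -/
theorem barPair_diagonal (hfg : ∀ i j, g i ≤ g j → f i ≤ f j)
    (h : ¬ (barSet f g p i).Nonempty) :
    (barPair f g p i).2 = ((barPair f g p i).1 : WithTop ℝ) := by
  unfold barSet at h
  unfold barPair
  split_ifs at h ⊢ with h1
  · rw [nonempty_Ico, not_lt] at h
    exact congrArg _ (le_antisymm h (hfg _ _ h1.le))
  · exact absurd nonempty_Ici h

end Decomposition

/-! ### Persistent homology as a sum of bars -/

section PersistentHomology

variable {k : Type u} [Field k] {V : Type v} {K : PreAbstractSimplicialComplex V}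
  {α : Type*} [LinearOrder α]
  {g : Simplex K → α} {c : Simplex K → Finset V →₀ k} {p : Simplex K → Simplex K}
  {f : Simplex K → ℝ}

theorem mem_sublevel {t : ℝ} {σ : Simplex K} : σ.1 ∈ sublevel K f t ↔ f σ ≤ t :=
  ⟨fun ⟨_, h⟩ => h, fun h => ⟨σ.2, h⟩⟩

theorem sublevel_subset (t : ℝ) : sublevel K f t ⊆ K.faces := fun _ ⟨h, _⟩ => h

/-- The coordinates of the cycles along the bars that are alive at `t`. -/
noncomputable def barCoordinates (φ : (Finset V →₀ k) →ₗ[k] (Simplex K → k)) {N : ℕ}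
    (idx : Fin N → Simplex K) (J : Fin N → BarInterval) (Z : Submodule k (Finset V →₀ k)) (t : ℝ) :
    Z →ₗ[k] ∀ j, PersistenceModule.intervalFibre k (J j).carrier t :=
  open Classical in
  LinearMap.pi fun j => LinearMap.codRestrict _
    (if t ∈ (J j).carrier then LinearMap.proj (idx j) ∘ₗ φ ∘ₗ Z.subtype else 0)
    (fun z ht => by rw [if_neg ht]; rfl)

open Classical in
theorem barCoordinates_apply (φ : (Finset V →₀ k) →ₗ[k] (Simplex K → k)) {N : ℕ}
    (idx : Fin N → Simplex K) (J : Fin N → BarInterval) (Z : Submodule k (Finset V →₀ k)) (t : ℝ)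
    (z : Z) (j : Fin N) : (barCoordinates φ idx J Z t z j : k) =
      if t ∈ (J j).carrier then φ z (idx j) else 0 := by
  simp only [barCoordinates, LinearMap.pi_apply]
  split_ifs <;> simp

variable [LinearOrder V] [Fintype (Simplex K)]

/-- A cycle at time `t` is sent to its coordinates along the bars alive at `t`. The remaining
coordinates belong to pairs already completed, so the kernel is the space of boundaries. Naturality
holds because the coordinates of a cycle do not depend on `t`. -/
theorem IsNormalForm.isIsomorphic
    (h : IsNormalForm (boundary k) (simplexChain k) g (fun σ : Simplex K => σ.1.card)
      Finset.univ c p) (hfg : ∀ σ τ, g σ ≤ g τ → f σ ≤ f τ) (q : ℕ) {N : ℕ}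
    (idx : Fin N → Simplex K) (hinj : Function.Injective idx) (J : Fin N → BarInterval)
    (hJ : ∀ j, (J j).carrier = barSet f g p (idx j))
    (hidx : ∀ j, (idx j).1.card = q + 1 ∧ g (idx j) ≤ g (p (idx j)))
    (hex : ∀ σ : Simplex K, σ.1.card = q + 1 → g σ ≤ g (p σ) → (barSet f g p σ).Nonempty →
      ∃ j, idx j = σ) :
    (persistentHomology k K f q).IsIsomorphic (PersistenceModule.finiteDirectSum fun j =>
      PersistenceModule.intervalModule k (J j).carrier (J j).ordConnected) := by
  classical
  obtain ⟨φ, hφ⟩ := h.linearIndependent.exists_coordinates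
  have hlow : ∀ t, ∀ σ τ : Simplex K, g σ ≤ g τ → τ.1 ∈ sublevel K f t → σ.1 ∈ sublevel K f t :=
    fun t σ τ hst hτ => mem_sublevel.2 ((hfg _ _ hst).trans (mem_sublevel.1 hτ))
  have hZ := fun t => h.cycles_eq (sublevel_subset t) (hlow t) q
  have hB := fun t => h.boundaries_eq (sublevel_subset t) (hlow t) q
  let Φ := fun t => barCoordinates φ idx J (cycles k (sublevel K f t) q) t
  have hker : ∀ t, (boundaries k (sublevel K f t) q).comap (cycles k (sublevel K f t) q).subtype =
      LinearMap.ker (Φ t) := by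
    intro t
    ext ⟨z, hz⟩
    rw [Submodule.mem_comap, Submodule.subtype_apply, LinearMap.mem_ker, hB]
    rw [hZ] at hz
    constructor
    · intro hz'
      funext j
      apply Subtype.ext
      rw [barCoordinates_apply]
      split_ifs with ht
      · refine coordinate_eq_zero hφ hz' fun hj => ?_
        rw [hJ, mem_barSet] at ht
        exact ht.2 ⟨hj.2, mem_sublevel.1 hj.1.1⟩
      · rfl
    · intro hz'
      refine mem_span_of_coordinates hφ hz fun σ hσ hne => ?_
      obtain ⟨⟨hσt, hσq⟩, hσp⟩ := hσ
      by_contra hnot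
      have ht : t ∈ barSet f g p σ := mem_barSet.2 ⟨mem_sublevel.1 hσt,
        fun h' => hnot ⟨⟨mem_sublevel.2 h'.2, hσq⟩, h'.1⟩⟩
      obtain ⟨j, rfl⟩ := hex σ hσq hσp ⟨t, ht⟩
      have := congrArg Subtype.val (congrFun hz' j)
      rw [barCoordinates_apply, if_pos ((hJ j).symm ▸ ht)] at this
      exact hne this
  have hsurj : ∀ t, Function.Surjective (Φ t) := by
    intro t y
    refine ⟨⟨∑ j, (y j : k) • c (idx j), ?_⟩, ?_⟩
    · rw [hZ]
      refine sum_mem fun j _ => ?_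
      by_cases ht : t ∈ (J j).carrier
      · refine Submodule.smul_mem _ _ (Submodule.subset_span ⟨idx j, ⟨⟨?_, (hidx j).1⟩,
          (hidx j).2⟩, rfl⟩)
        rw [hJ, mem_barSet] at ht
        exact mem_sublevel.2 ht.1
      · rw [(y j).2 ht, zero_smul]
        exact zero_mem _
    · funext j
      apply Subtype.ext
      rw [barCoordinates_apply]
      split_ifs with ht
      · simp only [map_sum, map_smul, hφ, Finset.sum_apply, Pi.smul_apply, smul_eq_mul]
        rw [Finset.sum_eq_single j]
        · simp
        · intro i _ hij
          rw [Pi.single_eq_of_ne (fun h' => hij (hinj h').symm), mul_zero]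
        · simp
      · exact ((y j).2 ht).symm
  refine ⟨fun t => (Submodule.quotEquivOfEq _ _ (hker t)).trans
    ((Φ t).quotKerEquivOfSurjective (hsurj t)), fun s t hst x => ?_⟩
  obtain ⟨⟨z, hz⟩, rfl⟩ := Submodule.Quotient.mk_surjective _ x
  funext j
  apply Subtype.ext
  change (Φ t ⟨z, cycles_mono k (sublevel_mono K f hst) q hz⟩ j : k) =
    if t ∈ (J j).carrier then (Φ s ⟨z, hz⟩ j : k) else 0
  rw [barCoordinates_apply, barCoordinates_apply]
  split_ifs with ht hs
  · rfl
  -- A bar alive at `t` but not at the earlier `s` is not yet born at `s`, so a cycle at `s` has no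
  -- component along it.
  · rw [hJ, mem_barSet] at ht hs
    rw [hZ] at hz
    refine coordinate_eq_zero hφ hz fun hj => hs ⟨mem_sublevel.1 hj.1.1, fun h' => ht.2
      ⟨h'.1, h'.2.trans hst⟩⟩
  · rfl

open Classical in
theorem IsNormalForm.isPersistenceDiagram
    (h : IsNormalForm (boundary k) (simplexChain k) g (fun σ : Simplex K => σ.1.card)
      Finset.univ c p) (hfg : ∀ σ τ, g σ ≤ g τ → f σ ≤ f τ) (q : ℕ) :
    IsPersistenceDiagram (persistentHomology k K f q)
      (Bar.ofMultiset ((Finset.univ.filter fun σ : Simplex K =>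
        σ.1.card = q + 1 ∧ g σ ≤ g (p σ)).val.map (barPair f g p))) := by
  let P : Simplex K → Prop := fun σ =>
    (σ.1.card = q + 1 ∧ g σ ≤ g (p σ)) ∧ (barSet f g p σ).Nonempty
  let ε : Fin (Fintype.card {σ // P σ}) ≃ {σ // P σ} := (Fintype.equivFin _).symm
  refine ⟨_, fun j => barInterval f g p (ε j).1 (ε j).2.2, h.isIsomorphic hfg q
    (fun j => (ε j).1) (Subtype.val_injective.comp ε.injective) _ (fun j => rfl)
    (fun j => (ε j).2.1) (fun σ h1 h2 h3 => ⟨ε.symm ⟨σ, ⟨h1, h2⟩, h3⟩, by simp⟩), ?_⟩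
  simp only [barInterval_point]
  rw [Multiset.map_univ_equiv_subtype P ε, ← Finset.filter_filter
    (fun σ : Simplex K => σ.1.card = q + 1 ∧ g σ ≤ g (p σ)) fun σ => (barSet f g p σ).Nonempty]
  -- The empty bars, which are not intervals of the decomposition, are put back as diagonal points.
  exact (Bar.ofMultiset_map_filter _ _ _ fun i _ hi => barPair_diagonal hfg hi).symm

end PersistentHomology

/-! ## Uniqueness of persistence diagrams -/

namespace PersistenceModule

variable {k : Type u} [Field k]

theorem IsIsomorphic.finrank_range_eq {A : PersistenceModule.{u, w} k}
    {B : PersistenceModule.{u, w'} k} (h : A.IsIsomorphic B) {s t : ℝ} (hst : s ≤ t) :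
    Module.finrank k (LinearMap.range (A.map hst)) =
      Module.finrank k (LinearMap.range (B.map hst)) := by
  obtain ⟨e, he⟩ := h
  have : LinearMap.range (B.map hst) =
      (LinearMap.range (A.map hst)).map (e t : A.obj t →ₗ[k] B.obj t) := by
    ext y
    constructor
    · rintro ⟨x, rfl⟩
      exact ⟨A.map hst ((e s).symm x), ⟨_, rfl⟩, by simp [he]⟩
    · rintro ⟨_, ⟨x, rfl⟩, rfl⟩
      exact ⟨e s x, (he s t hst x).symm⟩
  rw [this]
  exact (LinearEquiv.finrank_map_eq (e t) _).symm

open Classical in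
theorem finrank_range_intervals {N : ℕ} (J : Fin N → BarInterval) {s t : ℝ} (hst : s ≤ t) :
    Module.finrank k (LinearMap.range ((finiteDirectSum fun i =>
      intervalModule k (J i).carrier (J i).ordConnected).map hst)) =
      (Finset.univ.filter fun i => s ∈ (J i).carrier ∧ t ∈ (J i).carrier).card := by
  let I := {i // s ∈ (J i).carrier ∧ t ∈ (J i).carrier}
  -- Extension by zero from the coordinates of the intervals containing both `s` and `t`; its image
  -- is that of the structure map.
  let Ψ : (I → k) →ₗ[k] ∀ i, intervalFibre k (J i).carrier t := LinearMap.pi fun i =>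
    if h : s ∈ (J i).carrier ∧ t ∈ (J i).carrier then
      LinearMap.codRestrict _ (LinearMap.proj (⟨i, h⟩ : I)) (fun _ ht => absurd h.2 ht)
    else 0
  have hΨ : ∀ x i, (Ψ x i : k) =
      if h : s ∈ (J i).carrier ∧ t ∈ (J i).carrier then x ⟨i, h⟩ else 0 := by
    intro x i
    simp only [Ψ, LinearMap.pi_apply]
    split_ifs <;> rfl
  have hinj : Function.Injective Ψ := by
    intro x y hxy
    funext i
    have := congrArg Subtype.val (congrFun hxy i.1)
    rwa [hΨ, hΨ, dif_pos i.2, dif_pos i.2] at this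
  have hrange : LinearMap.range ((finiteDirectSum fun i =>
      intervalModule k (J i).carrier (J i).ordConnected).map hst) = LinearMap.range Ψ := by
    apply le_antisymm
    · rintro _ ⟨x, rfl⟩
      let y : ∀ i, intervalFibre k (J i).carrier s := x
      refine ⟨fun i => (y i.1 : k), ?_⟩
      funext i
      apply Subtype.ext
      rw [hΨ]
      change _ = if t ∈ (J i).carrier then (y i : k) else 0
      by_cases ht : t ∈ (J i).carrier
      · by_cases hs : s ∈ (J i).carrier
        · simp [hs, ht]
        · rw [show (y i : k) = 0 from (y i).2 hs]
          simp [hs]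
      · simp [ht]
    · rintro _ ⟨x, rfl⟩
      refine ⟨fun i => ⟨if h : s ∈ (J i).carrier ∧ t ∈ (J i).carrier then x ⟨i, h⟩ else 0,
        fun hs => dif_neg fun h => hs h.1⟩, ?_⟩
      funext i
      apply Subtype.ext
      rw [hΨ]
      change (if t ∈ (J i).carrier then _ else (0 : k)) = _
      by_cases ht : t ∈ (J i).carrier
      · simp [ht]
      · simp [ht]
  refine (congrArg (fun S : Submodule k (∀ i, intervalFibre k (J i).carrier t) =>
    Module.finrank k S) hrange).trans ?_
  rw [LinearMap.finrank_range_of_inj hinj, Module.finrank_fintype_fun_eq_card,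
    Fintype.card_subtype]

end PersistenceModule

/-! ### Recovering multiplicities from joint membership counts -/

namespace BarInterval

variable (J : BarInterval)

theorem point_fst_le {x : ℝ} (hx : x ∈ J.carrier) : J.point.1 ≤ x :=
  csInf_le J.bddBelow hx

theorem le_point_snd {x : ℝ} (hx : x ∈ J.carrier) : (x : WithTop ℝ) ≤ J.point.2 := by
  unfold point
  split_ifs with h
  · exact WithTop.coe_le_coe.2 (le_csSup h hx)
  · exact le_top

theorem mem_of_lt_of_lt {x : ℝ} (h1 : J.point.1 < x) (h2 : (x : WithTop ℝ) < J.point.2) :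
    x ∈ J.carrier := by
  obtain ⟨y, hy, hyx⟩ := exists_lt_of_csInf_lt J.nonempty h1
  obtain ⟨z, hz, hxz⟩ : ∃ z ∈ J.carrier, x < z := by
    unfold point at h2
    split_ifs at h2 with h
    · exact exists_lt_of_lt_csSup J.nonempty (WithTop.coe_lt_coe.1 h2)
    · exact (not_bddAbove_iff.1 h) x
  exact J.ordConnected.out hy hz ⟨hyx.le, hxz.le⟩

theorem point_fst_le_snd : (J.point.1 : WithTop ℝ) ≤ J.point.2 := by
  obtain ⟨x, hx⟩ := J.nonempty
  exact (WithTop.coe_le_coe.2 (J.point_fst_le hx)).trans (J.le_point_snd hx)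

theorem eventually_small {a : ℝ} (ha : 0 < a) : ∀ᶠ ε in 𝓝[>] (0 : ℝ), 0 < ε ∧ ε < a :=
  Ioo_mem_nhdsGT ha

/-- The point of an interval does not record whether its endpoints belong to it. Membership slightly
to the right or left of `b` avoids this ambiguity. -/
theorem eventually_add_mem (b : ℝ) : ∀ᶠ ε in 𝓝[>] (0 : ℝ),
    (b + ε ∈ J.carrier ↔ J.point.1 ≤ b ∧ (b : WithTop ℝ) < J.point.2) := by
  by_cases h1 : J.point.1 ≤ b
  · by_cases h2 : (b : WithTop ℝ) < J.point.2
    · obtain ⟨z, hbz, hz⟩ : ∃ z : ℝ, b < z ∧ (z : WithTop ℝ) ≤ J.point.2 := by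
        cases h : J.point.2 with
        | top => exact ⟨b + 1, by linarith, le_top⟩
        | coe r => exact ⟨r, WithTop.coe_lt_coe.1 (h ▸ h2), le_rfl⟩
      filter_upwards [eventually_small (sub_pos.2 hbz)] with ε hε
      refine iff_of_true (J.mem_of_lt_of_lt (by linarith) (lt_of_lt_of_le ?_ hz)) ⟨h1, h2⟩
      exact WithTop.coe_lt_coe.2 (by linarith)
    · filter_upwards [eventually_small one_pos] with ε hε
      refine iff_of_false (fun h => h2 ?_) (fun h => h2 h.2)
      exact lt_of_lt_of_le (WithTop.coe_lt_coe.2 (by linarith)) (J.le_point_snd h)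
  · filter_upwards [eventually_small (sub_pos.2 (not_le.1 h1))] with ε hε
    refine iff_of_false (fun h => ?_) (fun h => h1 h.1)
    have := J.point_fst_le h
    linarith

theorem eventually_sub_mem (b : ℝ) : ∀ᶠ ε in 𝓝[>] (0 : ℝ),
    (b - ε ∈ J.carrier ↔ J.point.1 < b ∧ (b : WithTop ℝ) ≤ J.point.2) := by
  by_cases h1 : J.point.1 < b
  · by_cases h2 : (b : WithTop ℝ) ≤ J.point.2
    · filter_upwards [eventually_small (sub_pos.2 h1)] with ε hε
      refine iff_of_true (J.mem_of_lt_of_lt (by linarith) (lt_of_lt_of_le ?_ h2)) ⟨h1, h2⟩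
      exact WithTop.coe_lt_coe.2 (by linarith)
    · obtain ⟨r, hr⟩ := WithTop.ne_top_iff_exists.1 (ne_top_of_lt (not_le.1 h2))
      rw [← hr, WithTop.coe_le_coe, not_le] at h2
      filter_upwards [eventually_small (sub_pos.2 h2)] with ε hε
      rw [← hr, WithTop.coe_le_coe]
      refine iff_of_false (fun h => ?_) (fun h => h2.not_ge h.2)
      have := J.le_point_snd h
      rw [← hr, WithTop.coe_le_coe] at this
      linarith
  · filter_upwards [eventually_small one_pos] with ε hε
    refine iff_of_false (fun h => ?_) (fun h => h1 h.1)
    have := J.point_fst_le h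
    linarith

/-- `ε⁻¹` serves as an arbitrarily late time, so infinite bars are detected along the same filter as
finite endpoints. -/
theorem eventually_inv_mem : ∀ᶠ ε in 𝓝[>] (0 : ℝ), (ε⁻¹ ∈ J.carrier ↔ J.point.2 = ⊤) := by
  cases h : J.point.2 with
  | top =>
    filter_upwards [tendsto_inv_nhdsGT_zero.eventually (eventually_gt_atTop J.point.1)] with ε hε
    exact iff_of_true (J.mem_of_lt_of_lt hε (h ▸ WithTop.coe_lt_top _)) rfl
  | coe r =>
    filter_upwards [tendsto_inv_nhdsGT_zero.eventually (eventually_gt_atTop r)] with ε hε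
    refine iff_of_false (fun h' => ?_) (WithTop.coe_ne_top)
    have := J.le_point_snd h'
    rw [h, WithTop.coe_le_coe] at this
    exact hε.not_ge this

open Classical in
/-- The number of intervals that contain both `s` and `t`. -/
noncomputable def jointCount {N : ℕ} (J : Fin N → BarInterval) (s t : ℝ) : ℤ :=
  ∑ i, if s ∈ (J i).carrier ∧ t ∈ (J i).carrier then 1 else 0

open Classical in
theorem count_points {N : ℕ} (J : Fin N → BarInterval) (x : BarPoint) :
    ((Multiset.count x (Finset.univ.val.map fun i => (J i).point) : ℕ) : ℤ) =
      ∑ i, if (J i).point = x then 1 else 0 := by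
  rw [Multiset.count_map, Finset.sum_boole]
  congr 1
  rw [Finset.card_def, Finset.filter_val]
  simp only [eq_comm]

open Classical in
-- The right side is a product of two differences of indicators. The first factor vanishes unless
-- `b` is an endpoint, the second unless `d` is; `b < d` then forces start `b` and end `d`.
theorem indicator_identity {a b d : ℝ} {S : WithTop ℝ} (hS : (a : WithTop ℝ) ≤ S) (hbd : b < d) :
    (if ((a, S) : BarPoint) = (b, (d : WithTop ℝ)) then (1 : ℤ) else 0) =
      (if (a ≤ b ∧ (b : WithTop ℝ) < S) ∧ (a < d ∧ (d : WithTop ℝ) ≤ S) then 1 else 0)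
      - (if (a < b ∧ (b : WithTop ℝ) ≤ S) ∧ (a < d ∧ (d : WithTop ℝ) ≤ S) then 1 else 0)
      - (if (a ≤ b ∧ (b : WithTop ℝ) < S) ∧ (a ≤ d ∧ (d : WithTop ℝ) < S) then 1 else 0)
      + (if (a < b ∧ (b : WithTop ℝ) ≤ S) ∧ (a ≤ d ∧ (d : WithTop ℝ) < S) then 1 else 0) := by
  cases S with
  | top =>
    simp only [Prod.mk.injEq, WithTop.coe_lt_top, le_top, WithTop.top_ne_coe, and_true, and_false]
    grind
  | coe S =>
    simp only [Prod.mk.injEq, WithTop.coe_lt_coe, WithTop.coe_le_coe, WithTop.coe_inj] at hS ⊢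
    grind

open Classical in
theorem eventually_count_finite {N : ℕ} (J : Fin N → BarInterval) {b d : ℝ} (hbd : b < d) :
    ∀ᶠ ε in 𝓝[>] (0 : ℝ),
      ((Multiset.count ((b, (d : WithTop ℝ)) : BarPoint)
        (Finset.univ.val.map fun i => (J i).point) : ℕ) : ℤ) =
      jointCount J (b + ε) (d - ε) - jointCount J (b - ε) (d - ε)
        - jointCount J (b + ε) (d + ε) + jointCount J (b - ε) (d + ε) := by
  filter_upwards [eventually_all.2 fun i => (J i).eventually_add_mem b,
    eventually_all.2 fun i => (J i).eventually_sub_mem b,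
    eventually_all.2 fun i => (J i).eventually_add_mem d,
    eventually_all.2 fun i => (J i).eventually_sub_mem d] with ε h1 h2 h3 h4
  rw [count_points, jointCount, jointCount, jointCount, jointCount, ← Finset.sum_sub_distrib,
    ← Finset.sum_sub_distrib, ← Finset.sum_add_distrib]
  refine Finset.sum_congr rfl fun i _ => ?_
  simp only [h1, h2, h3, h4]
  convert indicator_identity (J i).point_fst_le_snd hbd

open Classical in
theorem eventually_count_infinite {N : ℕ} (J : Fin N → BarInterval) (b : ℝ) :
    ∀ᶠ ε in 𝓝[>] (0 : ℝ),
      ((Multiset.count ((b, ⊤) : BarPoint)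
        (Finset.univ.val.map fun i => (J i).point) : ℕ) : ℤ) =
      jointCount J (b + ε) ε⁻¹ - jointCount J (b - ε) ε⁻¹ := by
  filter_upwards [eventually_all.2 fun i => (J i).eventually_add_mem b,
    eventually_all.2 fun i => (J i).eventually_sub_mem b,
    eventually_all.2 fun i => (J i).eventually_inv_mem] with ε h1 h2 h3
  rw [count_points, jointCount, jointCount, ← Finset.sum_sub_distrib]
  refine Finset.sum_congr rfl fun i _ => ?_
  simp only [h1, h2, h3]
  rcases hJ : (J i).point with ⟨a, S⟩
  cases S with
  | top =>
    simp only [Prod.mk.injEq, WithTop.coe_lt_top, le_top, and_true]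
    grind
  | coe S => simp

end BarInterval

/-- Ranks are isomorphism invariants and determine the joint counts, hence the multiplicities above
the diagonal and at infinity. On the diagonal both multiplicities are infinite, and below it both
are zero. -/
theorem IsPersistenceDiagram.unique {k : Type u} [Field k] {A : PersistenceModule.{u, w} k}
    {D D' : Bar} (h : IsPersistenceDiagram A D) (h' : IsPersistenceDiagram A D') : D = D' := by
  classical
  obtain ⟨N, J, hJ, rfl⟩ := h
  obtain ⟨N', J', hJ', rfl⟩ := h'
  have key : ∀ s t, s ≤ t → BarInterval.jointCount J s t = BarInterval.jointCount J' s t := by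
    intro s t hst
    have := (hJ.finrank_range_eq hst).symm.trans (hJ'.finrank_range_eq hst)
    rw [PersistenceModule.finrank_range_intervals, PersistenceModule.finrank_range_intervals]
      at this
    rw [BarInterval.jointCount, BarInterval.jointCount, Finset.sum_boole, Finset.sum_boole]
    exact_mod_cast this
  rw [Bar.ofMultiset_eq_iff]
  funext ⟨b, d⟩
  by_cases hd : d = (b : WithTop ℝ)
  · simp [withDiagonal, hd]
  simp only [withDiagonal, hd, if_false, add_zero, Nat.cast_inj]
  zify
  cases d with
  | top =>
    obtain ⟨ε, h1, h2, h3, h4⟩ := ((BarInterval.eventually_count_infinite J b).and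
      ((BarInterval.eventually_count_infinite J' b).and
      ((BarInterval.eventually_small one_pos).and
      (tendsto_inv_nhdsGT_zero.eventually (eventually_gt_atTop (b + 1)))))).exists
    rw [h1, h2, key _ _ (by linarith), key _ _ (by linarith)]
  | coe d =>
    rcases lt_or_ge b d with hbd | hbd
    -- Taking `ε` below half of `d - b` keeps `b + ε ≤ d - ε`, as a comparison of ranks requires.
    · obtain ⟨ε, h1, h2, h3⟩ := ((BarInterval.eventually_count_finite J hbd).and
        ((BarInterval.eventually_count_finite J' hbd).and
        (BarInterval.eventually_small (half_pos (sub_pos.2 hbd))))).exists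
      rw [h1, h2, key _ _ (by linarith), key _ _ (by linarith), key _ _ (by linarith),
        key _ _ (by linarith)]
    · have hlt : d < b := lt_of_le_of_ne hbd fun h => hd (by rw [h])
      have hz : ∀ {n : ℕ} (J : Fin n → BarInterval), Multiset.count ((b, (d : WithTop ℝ)) : BarPoint)
          (Finset.univ.val.map fun i => (J i).point) = 0 := by
        intro n J
        rw [Multiset.count_eq_zero]
        intro hx
        obtain ⟨i, -, hi⟩ := Multiset.mem_map.1 hx
        have := (J i).point_fst_le_snd
        rw [hi, WithTop.coe_le_coe] at this
        exact hlt.not_ge this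
      rw [hz, hz]

/-! ## The pairing of simplices -/

/-- The total pre-order of a filter function is refined by a linear order in which every simplex
comes after its proper faces. -/
theorem IsFilterFunction.exists_linear_refinement {V : Type v}
    {K : PreAbstractSimplicialComplex V} [Fintype (Simplex K)] {f : Simplex K → ℝ}
    (hf : IsFilterFunction K f) :
    ∃ g : Simplex K → ℝ ×ₗ (ℕ ×ₗ Fin (Fintype.card (Simplex K))), Function.Injective g ∧
      (∀ σ τ : Simplex K, σ.1 ⊂ τ.1 → g σ < g τ) ∧ ∀ σ τ, g σ ≤ g τ → f σ ≤ f τ := by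
  -- Lexicographic order: first the value, then the cardinality, which puts faces first among equal
  -- values, then an enumeration to break ties.
  refine ⟨fun σ => toLex (f σ, toLex (σ.1.card, Fintype.equivFin _ σ)), ?_, ?_, ?_⟩
  · intro σ τ h
    have h1 := congrArg (fun x => (ofLex (ofLex x).2).2) h
    exact (Fintype.equivFin _).injective h1
  · intro σ τ h
    rw [Prod.Lex.toLex_lt_toLex]
    rcases (hf σ τ h.subset).lt_or_eq with h1 | h1
    · exact Or.inl h1
    · exact Or.inr ⟨h1, Prod.Lex.toLex_lt_toLex.2 (Or.inl (Finset.card_lt_card h))⟩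
  · intro σ τ h
    rw [Prod.Lex.toLex_le_toLex] at h
    rcases h with h | h
    · exact h.le
    · exact h.1.le

section Pairing

variable {k : Type u} [Field k] {V : Type v} [LinearOrder V] {K : PreAbstractSimplicialComplex V}
  [Fintype (Simplex K)] {α : Type*} [LinearOrder α]
  {g : Simplex K → α} {c : Simplex K → Finset V →₀ k} {p : Simplex K → Simplex K}

open Classical in
-- Each simplex is exactly one of: first member of a pair, second member, unpaired. A second member
-- is listed in the degree of its partner, one below its own dimension.
theorem IsNormalForm.exists_pairing
    (h : IsNormalForm (boundary k) (simplexChain k) g (fun σ : Simplex K => σ.1.card)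
      Finset.univ c p) (hg : Function.Injective g) :
    ∃ e : TotalIndex (fun q : Fin (complexDim K + 1) => numFinite k K q)
        (fun q : Fin (complexDim K + 1) => numInfinite k K q) ≃ Simplex K,
      ∀ q : Fin (complexDim K + 1),
        (∃ ε : Fin (numFinite k K q) ≃ {σ : Simplex K // σ.1.card = q + 1 ∧ g σ < g (p σ)},
          ∀ i, e ⟨q, Sum.inl (i, 0)⟩ = ε i ∧ e ⟨q, Sum.inl (i, 1)⟩ = p (ε i)) ∧
        ∃ ε : Fin (numInfinite k K q) ≃ {σ : Simplex K // σ.1.card = q + 1 ∧ p σ = σ},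
          ∀ j, e ⟨q, Sum.inr j⟩ = ε j := by
  let ε (q : ℕ) : Fin (numFinite k K q) ≃ {σ : Simplex K // σ.1.card = q + 1 ∧ g σ < g (p σ)} :=
    (Fintype.equivFinOfCardEq (h.card_finite q)).symm
  let ε' (q : ℕ) : Fin (numInfinite k K q) ≃ {σ : Simplex K // σ.1.card = q + 1 ∧ p σ = σ} :=
    (Fintype.equivFinOfCardEq (h.card_infinite hg q)).symm
  let F : TotalIndex (fun q : Fin (complexDim K + 1) => numFinite k K q)
      (fun q : Fin (complexDim K + 1) => numInfinite k K q) → Simplex K := fun x =>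
    match x with
    | ⟨q, Sum.inl (i, a)⟩ => if a = 0 then (ε q i).1 else p (ε q i).1
    | ⟨q, Sum.inr j⟩ => (ε' q j).1
  have h0 : ∀ q i, F ⟨q, Sum.inl (i, 0)⟩ = (ε q i).1 := fun q i => if_pos rfl
  have h1 : ∀ q i, F ⟨q, Sum.inl (i, 1)⟩ = p (ε q i).1 := fun q i => if_neg (by decide)
  have h2 : ∀ q j, F ⟨q, Sum.inr j⟩ = (ε' q j).1 := fun q i => rfl
  have hinj : Function.Injective F := by
    rintro ⟨q, ⟨i, a⟩ | j⟩ ⟨q', ⟨i', a'⟩ | j'⟩ hF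
    · obtain ⟨hd, hp⟩ := (ε q i).2
      obtain ⟨hd', hp'⟩ := (ε q' i').2
      have key : (ε q i).1 = (ε q' i').1 → q = q' ∧ HEq i i' := by
        intro hE
        have hq : q = q' := by
          rw [hE, hd'] at hd
          exact Fin.ext (by omega)
        subst hq
        exact ⟨rfl, heq_of_eq ((ε q).injective (Subtype.ext hE))⟩
      fin_cases a <;> fin_cases a' <;> simp only [Fin.zero_eta, Fin.mk_one, h0, h1] at hF
      · obtain ⟨rfl, hi⟩ := key hF
        rw [eq_of_heq hi]
      · rw [hF, h.invol] at hp
        exact absurd hp hp'.not_gt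
      · rw [← hF, h.invol] at hp'
        exact absurd hp hp'.not_gt
      · have hF' := congrArg p hF
        rw [h.invol, h.invol] at hF'
        obtain ⟨rfl, hi⟩ := key hF'
        rw [eq_of_heq hi]
    · obtain ⟨hd, hp⟩ := (ε q i).2
      obtain ⟨hd', hp'⟩ := (ε' q' j').2
      fin_cases a <;> simp only [Fin.zero_eta, Fin.mk_one, h0, h1, h2] at hF
      · rw [hF, hp'] at hp
        exact absurd hp (lt_irrefl _)
      · rw [← hF, h.invol] at hp'
        rw [← hp'] at hp
        exact absurd hp (lt_irrefl _)
    · obtain ⟨hd, hp⟩ := (ε q' i').2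
      obtain ⟨hd', hp'⟩ := (ε' q j).2
      fin_cases a' <;> simp only [Fin.zero_eta, Fin.mk_one, h0, h1, h2] at hF
      · rw [← hF, hp'] at hp
        exact absurd hp (lt_irrefl _)
      · rw [hF, h.invol] at hp'
        rw [← hp'] at hp
        exact absurd hp (lt_irrefl _)
    · rw [h2, h2] at hF
      have hq : q = q' := by
        have hd := (ε' q j).2.1
        rw [hF, (ε' q' j').2.1] at hd
        exact Fin.ext (by omega)
      subst hq
      rw [(ε' q).injective (Subtype.ext hF)]
  have hdim : ∀ σ : Simplex K, ∃ q : Fin (complexDim K + 1), σ.1.card = q + 1 := by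
    intro σ
    have hpos : 0 < σ.1.card := Finset.card_pos.2 (K.isRelLowerSet_faces σ.2).1
    have hle : σ.1.card - 1 ≤ complexDim K :=
      Finset.le_sup (f := fun σ : Simplex K => σ.1.card - 1) (Finset.mem_univ σ)
    exact ⟨⟨σ.1.card - 1, by omega⟩, by simp only; omega⟩
  have hsurj : Function.Surjective F := by
    intro σ
    rcases lt_trichotomy (g σ) (g (p σ)) with hlt | heq | hlt
    · obtain ⟨q, hq⟩ := hdim σ
      exact ⟨⟨q, Sum.inl ((ε q).symm ⟨σ, hq, hlt⟩, 0)⟩, by rw [h0, Equiv.apply_symm_apply]⟩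
    · obtain ⟨q, hq⟩ := hdim σ
      exact ⟨⟨q, Sum.inr ((ε' q).symm ⟨σ, hq, (hg heq).symm⟩)⟩, by rw [h2, Equiv.apply_symm_apply]⟩
    · obtain ⟨q, hq⟩ := hdim (p σ)
      exact ⟨⟨q, Sum.inl ((ε q).symm ⟨p σ, hq, by rwa [h.invol]⟩, 1)⟩,
        by rw [h1, Equiv.apply_symm_apply, h.invol]⟩
  exact ⟨Equiv.ofBijective F ⟨hinj, hsurj⟩, fun q =>
    ⟨⟨ε q, fun i => ⟨h0 q i, h1 q i⟩⟩, ⟨ε' q, fun j => h2 q j⟩⟩⟩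

variable (k)

/-- The pairing of the simplices that is determined by the ordering class of a filter function
yields the persistence diagrams of all functions in the class. -/
theorem IsFilterFunction.exists_pairing {f₀ : Simplex K → ℝ} (hf : IsFilterFunction K f₀) :
    ∃ e : TotalIndex (fun q : Fin (complexDim K + 1) => numFinite k K q)
        (fun q : Fin (complexDim K + 1) => numInfinite k K q) ≃ Simplex K,
      ∀ f, OrderingEquivalent K f₀ f → ∀ q : Fin (complexDim K + 1),
        IsPersistenceDiagram (persistentHomology k K f q)
          (totalQuotientMap _ _ (fun i => f (e i)) q) := by
  classical
  obtain ⟨g, hg, hmono, hfg⟩ := hf.exists_linear_refinement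
  obtain ⟨c, p, h⟩ := exists_simplicial_normalForm k hg hmono
  obtain ⟨e, he⟩ := h.exists_pairing hg
  refine ⟨e, fun f hff q => ?_⟩
  obtain ⟨⟨ε, hε⟩, ε', hε'⟩ := he q
  -- The normal form was built from `g` alone, and `f`, inducing the same pre-order as `f₀`, is also
  -- monotone along `g`.
  convert h.isPersistenceDiagram (fun σ τ hst => (hff σ τ).1 (hfg σ τ hst)) q using 1
  have h1 : ∀ i, ((f (e ⟨q, Sum.inl (i, 0)⟩),
      ((f (e ⟨q, Sum.inl (i, 1)⟩) : ℝ) : WithTop ℝ)) : BarPoint) = barPair f g p (ε i) := by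
    intro i
    rw [(hε i).1, (hε i).2, barPair, if_pos (ε i).2.2]
  have h2 : ∀ j, ((f (e ⟨q, Sum.inr j⟩), ⊤) : BarPoint) = barPair f g p (ε' j) := by
    intro j
    rw [hε' j, barPair, (ε' j).2.2, if_neg (lt_irrefl _)]
  simp only [totalQuotientMap, quotientMap, component, ContinuousLinearMap.coe_pi',
    ContinuousLinearMap.proj_apply, h1, h2]
  rw [Multiset.map_univ_equiv_subtype _ ε, Multiset.map_univ_equiv_subtype _ ε', ← Multiset.map_add,
    ← Multiset.filter_add_not (fun σ => g σ < g (p σ)) (Finset.univ.filter fun σ : Simplex K =>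
        σ.1.card = q + 1 ∧ g σ ≤ g (p σ)).val, ← Finset.filter_val, ← Finset.filter_val,
    Finset.filter_filter, Finset.filter_filter]
  congr 4
  · ext σ
    simp only [Finset.mem_filter, Finset.mem_univ, true_and]
    exact ⟨fun h => ⟨⟨h.1, h.2.le⟩, h.2⟩, fun h => ⟨h.1.1, h.2⟩⟩
  · ext σ
    simp only [Finset.mem_filter, Finset.mem_univ, true_and]
    refine ⟨fun h => ?_, fun h => ⟨h.1.1, hg (le_antisymm (not_lt.1 h.2) h.1.2)⟩⟩
    rw [h.2]
    exact ⟨⟨h.1, le_rfl⟩, lt_irrefl _⟩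

end Pairing

/-! ## Directional derivatives -/

section Directional

variable {E : Type*} [NormedAddCommGroup E] [NormedSpace ℝ E]
  {M : Type*} [TopologicalSpace M] [ChartedSpace E M]
  {W W' : Type*} [NormedAddCommGroup W] [NormedSpace ℝ W] [NormedAddCommGroup W']
  [NormedSpace ℝ W'] {r : ℕ∞} {F : M → W} {S : Set M} {x : M}

theorem IsLocalExtension.clm_comp {U : Set M} {G : M → W} (T : W →L[ℝ] W') {F' : M → W'}
    (h : IsLocalExtension E r F S x U G) (hF : ∀ y ∈ S, F' y = T (F y)) :
    IsLocalExtension E r F' S x U (fun y => T (G y)) :=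
  ⟨h.1, h.2.1, T.contMDiff.comp_contMDiffOn h.2.2.1,
    fun y hy => (congrArg T (h.2.2.2 y hy)).trans (hF y hy.2).symm⟩

theorem IsDirectionalDerivative.clm_comp {L : TangentSpace 𝓘(ℝ, E) x →L[ℝ] W} (T : W →L[ℝ] W')
    {F' : M → W'} (h : IsDirectionalDerivative r F S x L) (hF : ∀ y ∈ S, F' y = T (F y)) :
    IsDirectionalDerivative r F' S x (T.comp L) := by
  obtain ⟨U, G, hG, hL⟩ := h
  exact ⟨U, _, hG.clm_comp T hF, T.hasMFDerivAt.comp x hL⟩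

theorem IsLocalExtension.exists_isDirectionalDerivative {U : Set M} {G : M → W}
    (h : IsLocalExtension E r F S x U G) (hr : 1 ≤ r) :
    ∃ L : TangentSpace 𝓘(ℝ, E) x →L[ℝ] W, IsDirectionalDerivative r F S x L := by
  have h1 := h.2.2.1.contMDiffAt (h.1.mem_nhds h.2.1)
  have h2 : (r : WithTop ℕ∞) ≠ 0 := by
    have : r ≠ 0 := (lt_of_lt_of_le zero_lt_one hr).ne'
    exact_mod_cast this
  exact ⟨_, U, G, h, (h1.mdifferentiableAt h2).hasMFDerivAt⟩

end Directional

/-! ## Permutations and ordering classes -/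

/-- The linear map that permutes coordinates. -/
noncomputable def permutationMap {α β : Type*} (e : α ≃ β) : (β → ℝ) →L[ℝ] (α → ℝ) :=
  ContinuousLinearMap.pi fun i => ContinuousLinearMap.proj (e i)

theorem permutationMap_apply {α β : Type*} (e : α ≃ β) (f : β → ℝ) (i : α) :
    permutationMap e f i = f (e i) := rfl

theorem toMatrix_mulVec_eq {α β : Type*} [Fintype β] [DecidableEq β] (e : α ≃ β)
    (f : β → ℝ) : (e.toPEquiv.toMatrix : Matrix α β ℝ).mulVec f = permutationMap e f := by
  rw [PEquiv.toMatrix_toPEquiv_mulVec]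
  rfl

section OrderingClass

variable {V : Type v} {K : PreAbstractSimplicialComplex V}

/-- The ordering class of a function. -/
def orderingClass (f : Simplex K → ℝ) : Set (Simplex K → ℝ) := {g | OrderingEquivalent K f g}

theorem mem_orderingClass_self (f : Simplex K → ℝ) : f ∈ orderingClass f := fun _ _ => Iff.rfl

theorem orderingClass_eq {f g : Simplex K → ℝ} (h : g ∈ orderingClass f) :
    orderingClass g = orderingClass f := by
  ext l
  exact ⟨fun h' σ τ => (h σ τ).trans (h' σ τ), fun h' σ τ => (h σ τ).symm.trans (h' σ τ)⟩

/-- The preimage of the class of `F x₀` is a union of strata, and the only stratum through `x₀` is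
`S` itself. -/
theorem exists_orderingClass_of_stratum {M : Type*} {𝒮 : Set (Set M)} (h𝒮 : Setoid.IsPartition 𝒮)
    {F : M → Simplex K → ℝ} (hw : IsWeaklyStratified 𝒮 (orderingClasses K) F) {S : Set M}
    (hS : S ∈ 𝒮) : ∃ f, ∀ x ∈ S, F x ∈ orderingClass f := by
  obtain ⟨x₀, hx₀⟩ := Setoid.nonempty_of_mem_partition h𝒮 hS
  obtain ⟨T, hT, hpre⟩ := hw (orderingClass (F x₀)) ⟨F x₀, rfl⟩
  have h0 : x₀ ∈ F ⁻¹' orderingClass (F x₀) := mem_orderingClass_self _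
  rw [hpre] at h0
  obtain ⟨S', hS', hx₀'⟩ := h0
  have hSS : S' = S := (h𝒮.2 x₀).unique ⟨hT hS', hx₀'⟩ ⟨hS, hx₀⟩
  refine ⟨F x₀, fun x hx => ?_⟩
  have : x ∈ F ⁻¹' orderingClass (F x₀) := hpre ▸ ⟨S', hS', hSS ▸ hx⟩
  exact this

end OrderingClass

/-! ### The map `Perm` and its values on filter functions -/

section Permutation

variable (k : Type u) [Field k] {V : Type v} [LinearOrder V] (K : PreAbstractSimplicialComplex V)
  [Fintype (Simplex K)]

/-- The coordinates of the ordered barcodes of filter functions on `K`. -/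
abbrev BarcodeIndex : Type :=
  TotalIndex (fun q : Fin (complexDim K + 1) => numFinite k K q)
    (fun q : Fin (complexDim K + 1) => numInfinite k K q)

/-- The bijection is attached to the class as a set, so choosing one per class makes the lift a
fixed permutation on it. -/
theorem exists_class_pairing (S : Set (Simplex K → ℝ)) :
    ∃ e : BarcodeIndex k K ≃ Simplex K, ∀ f, IsFilterFunction K f → S = orderingClass f →
      ∀ q : Fin (complexDim K + 1), IsPersistenceDiagram (persistentHomology k K f q)
        (totalQuotientMap _ _ (permutationMap e f) q) := by
  by_cases h : ∃ f₀, IsFilterFunction K f₀ ∧ S = orderingClass f₀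
  · obtain ⟨f₀, hf₀, rfl⟩ := h
    obtain ⟨e, he⟩ := hf₀.exists_pairing k
    exact ⟨e, fun f _ hS => he f (show f ∈ orderingClass f₀ from hS ▸ mem_orderingClass_self f)⟩
  -- A class without filter functions needs only some bijection; the one obtained from the zero
  -- filter function serves.
  · obtain ⟨e, -⟩ := IsFilterFunction.exists_pairing k (K := K) (f₀ := 0) fun _ _ _ => le_rfl
    exact ⟨e, fun f hf hS => absurd ⟨f, hf, hS⟩ h⟩

theorem card_barcodeIndex :
    ∑ q : Fin (complexDim K + 1), (2 * numFinite k K q + numInfinite k K q) =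
      Fintype.card (Simplex K) := by
  obtain ⟨e, -⟩ := exists_class_pairing k K ∅
  rw [← Fintype.card_congr e]
  simp [mul_comm]

/-- The pairing of the simplices chosen for an ordering class. -/
noncomputable def classPairing (S : Set (Simplex K → ℝ)) : BarcodeIndex k K ≃ Simplex K :=
  (exists_class_pairing k K S).choose

/-- The map that orders the values of a filter function as an ordered barcode. -/
noncomputable def orderedBarcode (f : Simplex K → ℝ) : BarcodeIndex k K → ℝ :=
  permutationMap (classPairing k K (orderingClass f)) f

variable {K}

theorem orderedBarcode_eq {f g : Simplex K → ℝ} (h : g ∈ orderingClass f) :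
    orderedBarcode k K g = permutationMap (classPairing k K (orderingClass f)) g := by
  rw [orderedBarcode, orderingClass_eq h]

theorem isPersistenceDiagram_orderedBarcode {f : Simplex K → ℝ} (hf : IsFilterFunction K f)
    (q : Fin (complexDim K + 1)) : IsPersistenceDiagram (persistentHomology k K f q)
      (totalQuotientMap _ _ (orderedBarcode k K f) q) :=
  (exists_class_pairing k K (orderingClass f)).choose_spec f hf rfl q

theorem isPersistenceDiagram_dgm {f : Simplex K → ℝ} (hf : IsFilterFunction K f)
    (q : Fin (complexDim K + 1)) :
    IsPersistenceDiagram (persistentHomology k K f q) (dgm k K q f) := by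
  have h : ∃ D, IsPersistenceDiagram (persistentHomology k K f q) D :=
    ⟨_, isPersistenceDiagram_orderedBarcode k hf q⟩
  rw [dgm, dif_pos h]
  exact h.choose_spec

theorem totalQuotientMap_orderedBarcode {f : Simplex K → ℝ} (hf : IsFilterFunction K f) :
    totalQuotientMap _ _ (orderedBarcode k K f) = fullDgm k K f :=
  funext fun q => (isPersistenceDiagram_orderedBarcode k hf q).unique
    (isPersistenceDiagram_dgm k hf q)

end Permutation

/-! ### The global lift and its directional derivatives -/

theorem mainTheorem6 {k : Type u} [Field k] {V : Type v} [LinearOrder V]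
    (K : PreAbstractSimplicialComplex V) [Fintype (Simplex K)] :
    ∃ (m n : Fin (complexDim K + 1) → ℕ) (Perm : (Simplex K → ℝ) → (TotalIndex m n → ℝ)),
      ∑ p, (2 * m p + n p) = Fintype.card (Simplex K) ∧
      (∀ S ∈ orderingClasses K, ∃ P : Matrix (TotalIndex m n) (Simplex K) ℝ,
        IsPermutationMatrix P ∧ ∀ f ∈ S, Perm f = P.mulVec f) ∧
      (∀ f : Simplex K → ℝ, IsFilterFunction K f →
        (∀ p : Fin (complexDim K + 1),
          IsPersistenceDiagram (persistentHomology k K f p) (dgm k K p f)) ∧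
        totalQuotientMap m n (Perm f) = fullDgm k K f) ∧
      ∀ (E : Type w) [NormedAddCommGroup E] [NormedSpace ℝ E] [FiniteDimensional ℝ E]
        (M : Type w') [TopologicalSpace M] [ChartedSpace E M] [IsManifold 𝓘(ℝ, E) ∞ M]
        (F : M → Simplex K → ℝ) (_hF : ∀ x, IsFilterFunction K (F x)),
        (∀ x, totalQuotientMap m n (Perm (F x)) = fullDgm k K (F x)) ∧
        ∀ (r : ℕ∞) (𝒮 : Set (Set M)),
          IsWhitneyStratification E 𝒮 →
          IsWeaklyStratified 𝒮 (orderingClasses K) F →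
          (∀ S ∈ 𝒮, ContMDiffOn 𝓘(ℝ, E) 𝓘(ℝ, Simplex K → ℝ) r F S) →
          (∀ x, ∀ S ∈ 𝒮, x ∈ closure S → ∃ U G, IsLocalExtension E r F S x U G) →
          ∀ S ∈ 𝒮, ∃ P : Matrix (TotalIndex m n) (Simplex K) ℝ,
            IsPermutationMatrix P ∧
            (∀ x ∈ S, Perm (F x) = P.mulVec (F x)) ∧
            ∀ x ∈ closure S,
              (∀ p, BarDifferentiableAlong E r (fun y => fullDgm k K (F y) p) S x) ∧
              (1 ≤ r →
                (∃ L : TangentSpace 𝓘(ℝ, E) x →L[ℝ] (TotalIndex m n → ℝ),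
                  IsDirectionalDerivative r (fun y => Perm (F y)) S x L) ∧
                ∀ L : TangentSpace 𝓘(ℝ, E) x →L[ℝ] (TotalIndex m n → ℝ),
                  (IsDirectionalDerivative r (fun y => Perm (F y)) S x L ↔
                    ∃ D : TangentSpace 𝓘(ℝ, E) x →L[ℝ] (Simplex K → ℝ),
                      IsDirectionalDerivative r F S x D ∧
                        ∀ ξ, L ξ = P.mulVec (D ξ)) ∧
                  (IsDirectionalDerivative r (fun y => Perm (F y)) S x L →
                    ∀ p, IsBarDirectionalDerivative r (fun y => fullDgm k K (F y) p) S x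
                      (m p) (n p) ((component m n p).comp L))) := by
  refine ⟨fun q => numFinite k K q, fun q => numInfinite k K q, orderedBarcode k K,
    card_barcodeIndex k K, ?_, fun f hf => ⟨isPersistenceDiagram_dgm k hf,
      totalQuotientMap_orderedBarcode k hf⟩, ?_⟩
  · rintro _ ⟨f, rfl⟩
    exact ⟨_, ⟨classPairing k K (orderingClass f), rfl⟩, fun g hg =>
      (orderedBarcode_eq k hg).trans (toMatrix_mulVec_eq _ _).symm⟩
  intro E _ _ _ M _ _ _ F hF
  have hQ := fun x => totalQuotientMap_orderedBarcode k (hF x)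
  refine ⟨hQ, fun r 𝒮 hW hweak _ hext S hS => ?_⟩
  obtain ⟨f, hf⟩ := exists_orderingClass_of_stratum hW.partition hweak hS
  set e := classPairing k K (orderingClass f)
  have hT : ∀ y ∈ S, orderedBarcode k K (F y) = permutationMap e (F y) :=
    fun y hy => orderedBarcode_eq k (hf y hy)
  -- Recovering `F` from the lift by the inverse permutation shows that every derivative of the lift
  -- comes from one of `F`.
  have hT' : ∀ y ∈ S, F y = permutationMap e.symm (orderedBarcode k K (F y)) := by
    intro y hy
    rw [hT y hy]
    funext σ
    simp [permutationMap_apply]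
  refine ⟨_, ⟨e, rfl⟩, fun y hy => (hT y hy).trans (toMatrix_mulVec_eq _ _).symm,
    fun x hx => ?_⟩
  obtain ⟨U, G, hG⟩ := hext x S hS hx
  -- Any local extension of the global lift, not only the permuted extension of `F`, projects to
  -- local lifts of the barcode components.
  have hlift : ∀ (U : Set M) (G : M → BarcodeIndex k K → ℝ),
      IsLocalExtension E r (fun y => orderedBarcode k K (F y)) S x U G →
      ∀ q, IsLocalLiftAlong E r (fun y => fullDgm k K (F y) q) S x U _ _
        (fun y => component _ _ q (G y)) := fun U G h q =>
    ⟨h.1, h.2.1, (component _ _ q).contMDiff.comp_contMDiffOn h.2.2.1, fun y hy =>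
      (congrFun (hQ y) q).symm.trans
        (congrArg (fun z => totalQuotientMap _ _ z q) (h.2.2.2 y hy).symm)⟩
  have hG' := hG.clm_comp (permutationMap e) hT
  refine ⟨fun q => ⟨U, _, _, _, hlift U _ hG' q⟩, fun hr =>
    ⟨hG'.exists_isDirectionalDerivative hr, fun L => ⟨⟨fun hL => ?_, ?_⟩, ?_⟩⟩⟩
  · refine ⟨_, hL.clm_comp (permutationMap e.symm) hT', fun ξ => ?_⟩
    rw [toMatrix_mulVec_eq]
    funext i
    simp [permutationMap_apply]
  · rintro ⟨D, hD, hLD⟩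
    have : L = (permutationMap e).comp D := by
      ext1 ξ
      rw [hLD ξ, toMatrix_mulVec_eq]
      rfl
    rw [this]
    exact hD.clm_comp (permutationMap e) hT
  · rintro ⟨U', G', hE, hL⟩ q
    exact ⟨U', _, hlift U' G' hE q, (component _ _ q).hasMFDerivAt.comp x hL⟩
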